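/- Let $\mathcal{E}$ be a finite nonempty set of strings (simple arcs in the plane, pairwise crossing transversally in finitely many points, with distinct endpoints and no three through a point) whose union is connected, colored blue and red so that the only crossings are between a blue and a red string. Ground $\mathcal{E}$ by adding one boundary curve through all string endpoints in each face that contains endpoints. Let $\mathcal{N}=(V,E)$ be its dual net: the vertices are the cells outside the boundary curves, each piece of a string between consecutive crossings or endpoints gives an edge joining the two cells at its sides, colored like the string, and each crossing is enclosed by one face of $\mathcal N$, a square. The border $B$ consists of the edges coming from pieces that contain an endpoint of a string. A vertex is regular if it has degree $4$ and meets no border edge; all other vertices are said to be on a hole. A straight path is a path of at least one non-border edge (its two ends may coincide) all of whose non-end vertices are regular and whose consecutive edges are opposite at their common vertex. A cut-set is a set of edge-disjoint straight paths (segments) each end of which is on a hole or in the interior of another path of the set. It is monochromatic if all its edges are blue or all are red. An edge set $X\subseteq E$ saturates $v\in V$ if every angle at $v$ between consecutive edges of $X\cup B$ sees at most two squares (if no edge of $X\cup B$ is incident with $v$ this condition fails), or if $v$ is regular and no edge of $X$ is incident with $v$; a cut-set is saturating if its edges saturate every vertex. Let $\exp_X(v)$ be the minimum number of edges at $v$ whose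 addition to $X$ gives a set saturating $v$, $\exp(v)=\exp_\emptyset(v)$, and let the marginal gain of a set $\mathcal S$ of segments with edge set $X$ be $g(\mathcal S)=\sum_{v\in V}(\exp(v)-\exp_X(v))-|\mathcal S|$. A rectangle is a set of squares whose crossings induce, in the planarization of $\mathcal E$, an $n\times m$ grid ($n,m\ge 1$) with rows and columns running along strings; a rectangulation is a partition of the squares into rectangles. A cut-set delimits it if its edges are exactly the edges that lie between squares of different rectangles. Let $S_{opt}$ be the minimum number of segments of a cut-set that delimits a rectangulation. The greedy strategy, started from a cut-set, processes the vertices of positive exponent in some linear order. At $v$ it saturates $v$ by shooting as few segments as possible, one after the other, from not yet covered edges at $v$; a shot segment runs straight until it first reaches a vertex that is on a hole or on an already present segment. Then there is a monochromatic cut-set $A$ that maximizes $g$ among all monochromatic cut-sets. Moreover, for every such $A$ and every linear order of the vertices of positive exponent, the greedy strategy started from $A$ can be carried out, and each of its runs ends with a saturating cut-set $\mathcal{S}_A$, in which no vertex is interior to two segments, with $$|\mathcal{S}_A|\le \tfrac32\, S_{opt}.$$ -/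

import Mathlib

open Equiv.Perm

/-- A connected set of strings (simple arcs, pairwise crossing transversally in finitely many
points, with pairwise distinct endpoints, no three through a point) drawn in the plane/sphere, given
by the rotation system of its planarization.

`D` is the set of darts: each *piece* (part of a string between two consecutive crossings or
endpoints) carries two darts, one for each direction; a dart starts at its *tail*.
`rev` reverses a dart and `rot` is the counterclockwise rotation of the darts around their tail.
The orbits of `rot` are the points of the planarization: crossings (orbits of size four) and
endpoints of strings (fixed points). A string runs straight through a crossing, i.e. it leaves
through the dart opposite to the one by which it arrived. -/
structure StringSystem (D : Type*) where
  rev : Equiv.Perm D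
  rot : Equiv.Perm D
  rev_rev : ∀ d, rev (rev d) = d
  rev_ne : ∀ d, rev d ≠ d
  rot_four : ∀ d, rot (rot (rot (rot d))) = d
  rot_two : ∀ d, rot d ≠ d → rot (rot d) ≠ d
  /-- every string is an arc with endpoints (not a closed curve);
  `rev.trans (rot.trans rot)` moves a dart one piece forward along its string
  and turns back at an endpoint -/
  arc : ∀ d, ∃ e, rot e = e ∧ SameCycle (rev.trans (rot.trans rot)) d e
  /-- no string crosses itself -/
  simple : ∀ d, rot d ≠ d → ¬ SameCycle (rev.trans (rot.trans rot)) d (rot d)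
  /-- the union of the strings is connected -/
  connected : ∀ d e, Relation.EqvGen (fun x y => y = rot x ∨ y = rev x) d e
  /-- Euler's formula: the surface is the sphere; the faces are the orbits of `rot⁻¹ ∘ rev` -/
  planar : Nat.card (Quotient (SameCycle.setoid rot))
      + Nat.card (Quotient (SameCycle.setoid (rev.trans rot.symm)))
    = Nat.card (Quotient (SameCycle.setoid rev)) + 2

namespace StringSystem

variable {D : Type*} (E : StringSystem D)

/-- One step forward along a string (turning back at an endpoint). -/
def fwd : Equiv.Perm D := E.rev.trans (E.rot.trans E.rot)

/-- One step along the boundary of the face to the left of a dart. -/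
def face : Equiv.Perm D := E.rev.trans E.rot.symm

/-- The tail of `d` is an endpoint of a string. -/
def IsEnd (d : D) : Prop := E.rot d = d

/-- Strings. -/
abbrev Str : Type _ := Quotient (SameCycle.setoid E.fwd)

/-- The string to which a dart belongs. -/
def str (d : D) : E.Str := Quotient.mk _ d

/-- Points of the planarization. -/
abbrev Pt : Type _ := Quotient (SameCycle.setoid E.rot)

/-- The tail of a dart. -/
def tail (d : D) : E.Pt := Quotient.mk _ d

/-- `c` (blue = `true`, red = `false`) colors the strings so that the only crossings are between a
blue and a red string. -/
def IsBipartition (c : E.Str → Bool) : Prop :=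
  ∀ d, ¬ E.IsEnd d → c (E.str d) ≠ c (E.str (E.rot d))

/-! ### The dual net

The strings are grounded by one boundary curve in each face that contains endpoints of strings.
This curve cuts such a face into cells, one between any two cyclically consecutive endpoints on the
boundary of the face. So a cell collects the darts to whose left it lies, where the boundary walk of
the face is interrupted at endpoints. The cells are the vertices of the net, its edges
are (dual to) the pieces, and the net-dart `d` leaves the cell to the left of `d` through the piece
of `d` and enters the cell to the left of `rev d`. -/

/-- Vertices of the net. -/
abbrev Cell : Type _ := Quot (fun d e : D => ¬ E.IsEnd (E.rev d) ∧ e = E.face d)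

/-- The vertex of the net from which the net-dart `d` leaves. -/
def cell (d : D) : E.Cell := Quot.mk _ d

/-- Edges of the net. -/
abbrev Edge : Type _ := Quotient (SameCycle.setoid E.rev)

/-- The edge of the net that belongs to a dart. -/
def edge (d : D) : E.Edge := Quotient.mk _ d

noncomputable instance [Finite D] : Fintype E.Cell := Fintype.ofFinite _

/-- The edge `e` is incident with the vertex `v`. -/
def Incident (e : E.Edge) (v : E.Cell) : Prop := ∃ d, E.edge d = e ∧ E.cell d = v

/-- The edges drawn on boundary curves: those whose piece contains an endpoint of its string. -/
def border : Set E.Edge := {e | ∃ d, E.IsEnd d ∧ E.edge d = e}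

/-- The degree of a vertex of the net (a loop counts twice). -/
noncomputable def degree (v : E.Cell) : ℕ := {d | E.cell d = v}.ncard

/-- Interior vertices of degree four. All other vertices are *on a hole*: they are
vertex-holes or lie on the boundary of a boundary-hole. -/
def Regular (v : E.Cell) : Prop :=
  (∀ e, E.Incident e v → e ∉ E.border) ∧ E.degree v = 4

/-! ### Segments and cut-sets -/

/-- A straight path, as the list of its net-darts in the order of traversal: a trail
of at least one interior edge such that all non-end vertices are regular and consecutive edges are
opposite in the rotation at their common vertex. (Its two ends may be the same hole.) -/
def IsStraight (p : List D) : Prop :=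
  p ≠ [] ∧ (∀ d ∈ p, E.edge d ∉ E.border) ∧ (p.map E.edge).Nodup ∧
    p.IsChain (fun d e => E.Regular (E.cell (E.rev d)) ∧ e = E.face (E.face (E.rev d)))

/-- The vertex `v` is the first or the last vertex of the path. -/
def IsEndOf (p : List D) (v : E.Cell) : Prop :=
  (∃ d ∈ p.head?, v = E.cell d) ∨ (∃ d ∈ p.getLast?, v = E.cell (E.rev d))

/-- The vertex `v` is a non-end vertex of the path. -/
def IsInnerOf (p : List D) (v : E.Cell) : Prop :=
  ∃ d ∈ p.dropLast, v = E.cell (E.rev d)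

/-- The edges covered by a set of paths. -/
def edges (S : Finset (List D)) : Set E.Edge := {e | ∃ p ∈ S, ∃ d ∈ p, E.edge d = e}

/-- Cut-sets: edge-disjoint straight paths such that each end of a path is on a hole or in the
interior of another path. -/
def IsCutSet (S : Finset (List D)) : Prop :=
  (∀ p ∈ S, E.IsStraight p) ∧
  (∀ p ∈ S, ∀ q ∈ S, p ≠ q → ∀ d ∈ p, ∀ e ∈ q, E.edge d ≠ E.edge e) ∧
  (∀ p ∈ S, ∀ v, E.IsEndOf p v → ¬ E.Regular v ∨ ∃ q ∈ S, q ≠ p ∧ E.IsInnerOf q v)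

/-- No vertex is in the interior of two of the segments. -/
def IsNoncrossing (S : Finset (List D)) : Prop :=
  ∀ p ∈ S, ∀ q ∈ S, p ≠ q → ∀ v, E.IsInnerOf p v → ¬ E.IsInnerOf q v

/-- All segments of `S` are blue, or all are red (an edge of the net has the color of the string
that crosses it). -/
def IsMonochromatic (c : E.Str → Bool) (S : Finset (List D)) : Prop :=
  ∃ b, ∀ p ∈ S, ∀ d ∈ p, c (E.str d) = b

/-! ### Rectangulations -/

/-- The crossing at a point of the planarization; the squares of the net correspond to
the crossings that they enclose. -/
def IsCrossing (x : E.Pt) : Prop := ∃ d, E.tail d = x ∧ ¬ E.IsEnd d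

/-- A rectangle, as a set of squares: the enclosed crossings can be arranged as an `n × m`
grid, where `f i j` is the dart that leaves the crossing at position `(i, j)` to the east, rows
(going east) and columns (going north) follow the strings, and the grid is induced, i.e. every piece
that joins two crossings of the rectangle is an edge of the grid. -/
def IsRectangle (Q : Set E.Pt) : Prop :=
  ∃ (n m : ℕ) (f : ℕ → ℕ → D), 1 ≤ n ∧ 1 ≤ m ∧
    (∀ i < n, ∀ j < m, ¬ E.IsEnd (f i j)) ∧
    (∀ i < n, ∀ j < m, ∀ k < n, ∀ l < m,
      E.tail (f i j) = E.tail (f k l) → i = k ∧ j = l) ∧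
    Q = {x | ∃ i < n, ∃ j < m, E.tail (f i j) = x} ∧
    (∀ i j, i < n → j + 1 < m → E.rev (f i j) = E.rot (E.rot (f i (j + 1)))) ∧
    (∀ i j, i + 1 < n → j < m →
      E.rev (E.rot (f i j)) = E.rot (E.rot (E.rot (f (i + 1) j)))) ∧
    (∀ d, E.tail d ∈ Q → E.tail (E.rev d) ∈ Q →
      (∃ i j, i < n ∧ j + 1 < m ∧ E.edge d = E.edge (f i j)) ∨
      (∃ i j, i + 1 < n ∧ j < m ∧ E.edge d = E.edge (E.rot (f i j))))

/-- A partition of the squares into rectangles. -/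
def IsRectangulation (R : Set (Set E.Pt)) : Prop :=
  (∀ Q ∈ R, E.IsRectangle Q) ∧ ∀ x, E.IsCrossing x → ∃! Q, Q ∈ R ∧ x ∈ Q

/-- Separating edges: those on the boundary of two squares that belong to different rectangles
(the edge of `d` is on the boundary of the squares of the two ends of the piece of `d`). -/
def IsSeparating (R : Set (Set E.Pt)) (e : E.Edge) : Prop :=
  ∃ d, E.edge d = e ∧ ∃ Q ∈ R, ∃ Q' ∈ R, Q ≠ Q' ∧ E.tail d ∈ Q ∧ E.tail (E.rev d) ∈ Q'

/-- The segments of `S` consist of separating edges and cover all of them. -/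
def Delimits (S : Finset (List D)) (R : Set (Set E.Pt)) : Prop :=
  ∀ e, e ∈ E.edges S ↔ E.IsSeparating R e

/-- The minimum number of segments of a cut-set that delimits a rectangulation. -/
noncomputable def sOpt : ℕ :=
  sInf {k | ∃ S R, E.IsCutSet S ∧ E.IsRectangulation R ∧ E.Delimits S R ∧ S.card = k}

/-! ### Saturation, exponents and marginal gain -/

/-- `X` saturates `v`: each angle at `v` formed by the edges of `X` and the border sees at most two
squares, or `v` is regular and meets no edge of `X`. The angle at `v` between the
consecutive net-darts `d` and `face d` sees one square (if the tail of `rev d` is a crossing; otherwise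
it is the angle of a boundary-hole). Hence an angle sees three squares or more iff there are two
consecutive edges strictly inside it, which are neither in `X` nor in the border. -/
def Saturates (X : Set E.Edge) (v : E.Cell) : Prop :=
  (E.Regular v ∧ ∀ e, E.Incident e v → e ∉ X) ∨
  ∀ d, E.cell d = v → ¬ E.IsEnd (E.rev d) →
    E.edge d ∈ X ∪ E.border ∨ E.edge (E.face d) ∈ X ∪ E.border

/-- The exponent of `v` relative to `X`: the minimum number of edges at `v` whose addition
to `X` yields a set that saturates `v`. -/
noncomputable def relExp (X : Set E.Edge) (v : E.Cell) : ℕ :=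
  sInf {k | ∃ F : Finset E.Edge, (∀ e ∈ F, E.Incident e v) ∧ E.Saturates (X ∪ ↑F) v ∧ F.card = k}

/-- The exponent of a vertex. -/
noncomputable def exponent (v : E.Cell) : ℕ := E.relExp ∅ v

/-- The marginal gain of a set of segments. -/
noncomputable def gain [Finite D] (S : Finset (List D)) : ℤ :=
  ∑ v : E.Cell, ((E.exponent v : ℤ) - (E.relExp (E.edges S) v : ℤ)) - (S.card : ℤ)

/-- `A` has maximum marginal gain among all monochromatic cut-sets. -/
def IsMaxGain [Finite D] (c : E.Str → Bool) (A : Finset (List D)) : Prop :=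
  E.IsCutSet A ∧ E.IsMonochromatic c A ∧
    ∀ A', E.IsCutSet A' → E.IsMonochromatic c A' → E.gain A' ≤ E.gain A

/-! ### The greedy strategy -/

/-- The vertex `v` lies on a segment of `S`. -/
def Touches (S : Finset (List D)) (v : E.Cell) : Prop :=
  ∃ e ∈ E.edges S, E.Incident e v

/-- `p` is the segment shot from the uncovered net-dart `d` at its vertex: it extends straight on
up to the first vertex that is on a hole or on a segment of `S`. -/
def IsShot (S : Finset (List D)) (d : D) (p : List D) : Prop :=
  E.IsStraight p ∧ p.head? = some d ∧ E.edge d ∉ E.edges S ∧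
    (∀ v, E.IsInnerOf p v → ¬ E.Touches S v) ∧
    ∀ e ∈ p.getLast?, ¬ E.Regular (E.cell (E.rev e)) ∨ E.Touches S (E.cell (E.rev e))

variable [DecidableEq D]

/-- `Shoots v S n S'`: `S'` arises from `S` by shooting `n` segments, one after the other, from
uncovered edges at `v`. -/
inductive Shoots (v : E.Cell) : Finset (List D) → ℕ → Finset (List D) → Prop
  | nil (S : Finset (List D)) : Shoots v S 0 S
  | cons {S S' : Finset (List D)} {n : ℕ} {d : D} {p : List D} (hv : E.cell d = v)
      (hp : E.IsShot S d p) (h : Shoots v (insert p S) n S') : Shoots v S (n + 1) S'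

/-- One step of the greedy strategy: saturate `v` by shooting as few segments from it as
possible. -/
def GreedyStep (v : E.Cell) (S S' : Finset (List D)) : Prop :=
  ∃ n, E.Shoots v S n S' ∧ E.Saturates (E.edges S') v ∧
    ∀ m S'', E.Shoots v S m S'' → E.Saturates (E.edges S'') v → n ≤ m

/-- `Greedy vs S S'`: a run of the greedy strategy that starts from `S` and treats the vertices in
the list `vs` in this order can end with `S'`. -/
inductive Greedy : List E.Cell → Finset (List D) → Finset (List D) → Prop
  | nil (S : Finset (List D)) : Greedy [] S S
  | cons {v : E.Cell} {vs : List E.Cell} {S S' S'' : Finset (List D)}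
      (hv : E.GreedyStep v S S') (h : Greedy vs S' S'') : Greedy (v :: vs) S S''

end StringSystem

/-! Let Φ(S) = |S| + ∑ exp_S(v), with exponents relative to the edges of S. By `gain_eq` the
marginal gain is a constant minus Φ, so A minimizes Φ among monochromatic cut-sets. The bound comes
from squeezing Φ(A).

From below: every cut-set saturates all regular vertices (`IsCutSet.saturates_of_regular`), so only
vertices on holes matter. Treating such a vertex v costs at most exp_S(v) shots, brings its exponent
to 0 and raises no other exponent. Hence Φ never increases along a greedy run (`Greedy.spec`), and
the run ends with |S_A| ≤ Φ(A).

From above: let S be any saturating cut-set, and let B₁, B₂ be its blue and its red segments with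
both ends on holes. Each is a monochromatic cut-set, and `exists_monochromatic` proves Φ(B₁) + Φ(B₂)
≤ 3|S|, so 2Φ(A) ≤ 3|S|. To see this, put F = B₁ ∪ B₂ and let h(X) count the darts that leave holes
through edges of X. Colors alternate around a hole, so a saturating set takes at least half of the
non-border darts there or exactly one color class (`Saturates.half_or_color`). This yields a local
estimate whose sum over all vertices is ∑ exp_{B₁} + ∑ exp_{B₂} + h(F) ≤ 2h(S). A segment outside F
has at most one end on a hole, so h(S) ≤ h(F) + |S| − |F|; also h(F) ≤ 2|F| and |F| ≤ |S|. Together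
these give 3|S|.

Finally, a cut-set that delimits a rectangulation is saturating (`Delimits.saturates`), and the
minimum S_opt is attained because some delimiting cut-set exists (`sOpt_spec`). -/

namespace StringSystem

/-! ### Strings, edges and cells in terms of darts -/

section Basic
variable {D : Type*} (E : StringSystem D)

theorem face_apply (d : D) : E.face d = E.rot.symm (E.rev d) := rfl

theorem fwd_apply (d : D) : E.fwd d = E.rot (E.rot (E.rev d)) := rfl

theorem rot_face (d : D) : E.rot (E.face d) = E.rev d := by
  simp [face_apply]

theorem isEnd_rot (d : D) : E.IsEnd (E.rot d) ↔ E.IsEnd d := by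
  simp [IsEnd]

theorem isEnd_face (d : D) : E.IsEnd (E.face d) ↔ E.IsEnd (E.rev d) := by
  rw [← E.rot_face d, isEnd_rot]

theorem str_eq_iff (d e : D) : E.str d = E.str e ↔ SameCycle E.fwd d e :=
  Quotient.eq (r := SameCycle.setoid E.fwd)

theorem tail_eq_iff (d e : D) : E.tail d = E.tail e ↔ SameCycle E.rot d e :=
  Quotient.eq (r := SameCycle.setoid E.rot)

theorem str_fwd (d : D) : E.str (E.fwd d) = E.str d := by
  rw [str_eq_iff]
  exact sameCycle_apply_left.2 (SameCycle.refl _ _)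

theorem tail_rot (d : D) : E.tail (E.rot d) = E.tail d := by
  rw [tail_eq_iff]
  exact sameCycle_apply_left.2 (SameCycle.refl _ _)

theorem fwd_rev_fwd (d : D) : E.fwd (E.rev (E.fwd d)) = E.rev d := by
  simp only [fwd_apply, E.rev_rev, E.rot_four]

/-- Reversal conjugates `fwd` to its inverse: traversing a string backwards undoes traversing it
forwards. -/
theorem fwd_zpow_rev (d : D) (k : ℤ) :
    (E.fwd ^ k) (E.rev d) = E.rev ((E.fwd ^ (-k)) d) := by
  have hconj : ∀ x, E.fwd⁻¹ (E.rev x) = E.rev (E.fwd x) := fun x => by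
    rw [inv_eq_iff_eq, fwd_rev_fwd]
  have h1 : (E.rev * E.fwd * E.rev⁻¹) = E.fwd⁻¹ := by
    ext x
    have hx : E.rev⁻¹ x = E.rev x := by rw [inv_eq_iff_eq, E.rev_rev]
    simp only [mul_apply, hx]
    rw [← hconj, E.rev_rev]
  have h2 : E.fwd = E.rev * E.fwd⁻¹ * E.rev⁻¹ := by
    rw [← conj_inv, h1, inv_inv]
  rw [h2, conj_zpow, inv_zpow', ← h2]
  simp [mul_apply]

/-- A string is an arc, and `fwd` turns back at its endpoint, so one `fwd`-orbit contains both
directions of every piece. -/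
theorem str_rev (d : D) : E.str (E.rev d) = E.str d := by
  obtain ⟨e, he, k, hk⟩ := E.arc d
  change (E.fwd ^ k) d = e at hk
  have h1 : E.fwd (E.rev e) = e := by rw [fwd_apply, E.rev_rev, he, he]
  have h2 : E.str (E.rev e) = E.str e := by rw [← E.str_fwd (E.rev e), h1]
  have h3 : E.str d = E.str e := (E.str_eq_iff _ _).2 ⟨k, hk⟩
  have h4 : E.str (E.rev d) = E.str (E.rev e) :=
    (E.str_eq_iff _ _).2 ⟨-k, by rw [fwd_zpow_rev, neg_neg, hk]⟩
  rw [h4, h2, h3]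

theorem str_rot_rot (d : D) : E.str (E.rot (E.rot d)) = E.str d := by
  have h := E.str_fwd (E.rev d)
  rwa [fwd_apply, E.rev_rev, str_rev] at h

-- Consecutive darts around a cell belong to strings that cross at their common corner, so the
-- colors alternate.
variable {E} in
theorem IsBipartition.face {c : E.Str → Bool} (hc : E.IsBipartition c) {d : D}
    (h : ¬ E.IsEnd (E.rev d)) : c (E.str (E.face d)) = !c (E.str d) := by
  have h1 := hc (E.face d) (by rwa [isEnd_face])
  rw [rot_face, str_rev] at h1
  revert h1
  cases c (E.str (E.face d)) <;> cases c (E.str d) <;> simp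

theorem edge_eq_iff (d e : D) : E.edge d = E.edge e ↔ e = d ∨ e = E.rev d := by
  have h : E.edge d = E.edge e ↔ SameCycle E.rev d e :=
    Quotient.eq (r := SameCycle.setoid E.rev)
  rw [h]
  have h2 : E.rev ^ 2 = 1 := by
    ext x
    simp [pow_two, E.rev_rev]
  constructor
  · rintro ⟨k, rfl⟩
    rcases Int.even_or_odd' k with ⟨m, rfl | rfl⟩
    · left
      rw [zpow_mul, zpow_ofNat, h2, one_zpow, one_apply]
    · right
      rw [zpow_add, zpow_mul, zpow_ofNat, h2, one_zpow, one_mul, zpow_one]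
  · rintro (rfl | rfl)
    · exact SameCycle.refl _ _
    · exact sameCycle_apply_right.2 (SameCycle.refl _ _)

theorem edge_rev (d : D) : E.edge (E.rev d) = E.edge d := by
  rw [edge_eq_iff, E.rev_rev]
  exact Or.inr rfl

theorem edge_mem_border_iff (d : D) : E.edge d ∈ E.border ↔ E.IsEnd d ∨ E.IsEnd (E.rev d) := by
  constructor
  · rintro ⟨e, he, h⟩
    rcases (E.edge_eq_iff _ _).1 h with rfl | rfl
    · exact Or.inl he
    · rw [E.rev_rev]
      exact Or.inr he
  · rintro (h | h)
    · exact ⟨d, h, rfl⟩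
    · exact ⟨_, h, E.edge_rev d⟩

theorem cell_face {d : D} (h : ¬ E.IsEnd (E.rev d)) : E.cell (E.face d) = E.cell d :=
  (Quot.sound ⟨h, rfl⟩).symm

variable {E} in
/-- A property of darts that is preserved along the boundary walks of the cells is constant on
cells. -/
theorem iff_of_cell_eq {P : D → Prop}
    (hP : ∀ d, ¬ E.IsEnd (E.rev d) → (P d ↔ P (E.face d))) {d e : D}
    (h : E.cell d = E.cell e) : P d ↔ P e := by
  let Q : E.Cell → Prop := Quot.lift P (by
    rintro x y ⟨h1, rfl⟩
    exact propext (hP x h1))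
  change Q (E.cell d) ↔ Q (E.cell e)
  rw [h]

theorem incident_cell (d : D) : E.Incident (E.edge d) (E.cell d) := ⟨d, rfl, rfl⟩

theorem incident_cell_rev (d : D) : E.Incident (E.edge d) (E.cell (E.rev d)) :=
  ⟨_, E.edge_rev d, rfl⟩

end Basic

/-! ### Regular cells: four darts, opposite pairs, no loops -/

section Regular
variable {D : Type*} {E : StringSystem D}

theorem Regular.edge_notMem_border {d : D} (h : E.Regular (E.cell d)) : E.edge d ∉ E.border :=
  h.1 _ (E.incident_cell d)

theorem Regular.not_isEnd_rev {d : D} (h : E.Regular (E.cell d)) : ¬ E.IsEnd (E.rev d) :=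
  fun h1 => h.edge_notMem_border ((E.edge_mem_border_iff d).2 (Or.inr h1))

theorem Regular.cell_face {d : D} (h : E.Regular (E.cell d)) :
    E.cell (E.face d) = E.cell d := E.cell_face h.not_isEnd_rev

theorem sameCycle_face_of_cell_eq {d e : D} (h : E.cell d = E.cell e) : SameCycle E.face d e :=
  (iff_of_cell_eq (E := E) (P := fun x => SameCycle E.face d x)
    (fun _ _ => sameCycle_apply_right.symm) h).1 (SameCycle.refl _ _)

theorem Regular.cell_face_pow {d : D} (h : E.Regular (E.cell d)) (k : ℕ) :
    E.cell ((E.face ^ k) d) = E.cell d := by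
  induction k with
  | zero => rfl
  | succ k ih =>
    rw [pow_succ', mul_apply, Regular.cell_face (by rwa [ih]), ih]

/-- No border piece interrupts the boundary walk of a regular cell, so the cell is a full
`face`-orbit and its degree is the length of that orbit. -/
theorem Regular.face_pow_four [Finite D] {d : D} (h : E.Regular (E.cell d)) :
    (E.face ^ 4) d = d ∧
      ∀ e, E.cell e = E.cell d → ∃ k < 4, e = (E.face ^ k) d := by
  classical
  have := Fintype.ofFinite D
  have hset : {e | E.cell e = E.cell d} = MulAction.orbit (Subgroup.zpowers E.face) d := by
    ext e
    constructor
    · intro he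
      obtain ⟨k, hk⟩ := sameCycle_face_of_cell_eq (E := E) (Eq.symm he)
      exact ⟨⟨E.face ^ k, k, rfl⟩, hk⟩
    · rintro ⟨⟨_, k, rfl⟩, rfl⟩
      have h2 : SameCycle E.face d ((E.face ^ k) d) := ⟨k, rfl⟩
      obtain ⟨n, hn⟩ := h2.exists_nat_pow_eq
      change E.cell ((E.face ^ k) d) = _
      rw [← hn, h.cell_face_pow]
  have hcard : Function.minimalPeriod (E.face • ·) d = 4 := by
    rw [MulAction.minimalPeriod_eq_card, ← h.2, degree, hset, Set.ncard_eq_toFinset_card',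
      Set.toFinset_card]
  have hper : Function.IsPeriodicPt E.face 4 d := by
    have := Function.isPeriodicPt_minimalPeriod (E.face • ·) d
    rwa [hcard] at this
  have h4 : (E.face ^ 4) d = d := by
    rw [← Equiv.Perm.iterate_eq_pow]
    exact hper
  refine ⟨h4, fun e he => ?_⟩
  obtain ⟨n, hn⟩ := (sameCycle_face_of_cell_eq (E := E) (Eq.symm he)).exists_nat_pow_eq
  refine ⟨n % 4, Nat.mod_lt _ (by norm_num), ?_⟩
  rw [← hn, ← Equiv.Perm.iterate_eq_pow, ← Equiv.Perm.iterate_eq_pow]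
  exact (hper.iterate_mod_apply n).symm

theorem Regular.face_face_face {c : E.Str → Bool} (hc : E.IsBipartition c) {d : D}
    (h : E.Regular (E.cell d)) : c (E.str (E.face (E.face d))) = c (E.str d) := by
  have h1 : E.Regular (E.cell (E.face d)) := by rwa [h.cell_face]
  rw [hc.face h1.not_isEnd_rev, hc.face h.not_isEnd_rev, Bool.not_not]

variable [Finite D]

theorem Regular.face_four {d : D} (h : E.Regular (E.cell d)) :
    E.face (E.face (E.face (E.face d))) = d := h.face_pow_four.1

theorem Regular.eq_or_of_cell_eq {d e : D} (h : E.Regular (E.cell d)) (he : E.cell e = E.cell d) :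
    e = d ∨ e = E.face d ∨ e = E.face (E.face d) ∨ e = E.face (E.face (E.face d)) := by
  obtain ⟨k, hk, rfl⟩ := h.face_pow_four.2 e he
  interval_cases k
  · exact Or.inl rfl
  · exact Or.inr (Or.inl rfl)
  · exact Or.inr (Or.inr (Or.inl rfl))
  · exact Or.inr (Or.inr (Or.inr rfl))

/-- Two darts of the same color at a regular cell are equal or opposite. -/
theorem Regular.eq_or_eq_of_color {c : E.Str → Bool} (hc : E.IsBipartition c) {d e : D}
    (h : E.Regular (E.cell d)) (he : E.cell e = E.cell d) (hcol : c (E.str e) = c (E.str d)) :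
    e = d ∨ e = E.face (E.face d) := by
  have h1 : E.Regular (E.cell (E.face d)) := by rwa [h.cell_face]
  rcases h.eq_or_of_cell_eq he with rfl | rfl | rfl | rfl
  · exact Or.inl rfl
  · rw [hc.face h.not_isEnd_rev] at hcol
    simp at hcol
  · exact Or.inr rfl
  · rw [h1.face_face_face hc, hc.face h.not_isEnd_rev] at hcol
    simp at hcol

/-- There are no loops at regular cells. -/
theorem Regular.cell_rev_ne {c : E.Str → Bool} (hc : E.IsBipartition c) {d : D}
    (h : E.Regular (E.cell d)) : E.cell (E.rev d) ≠ E.cell d := by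
  intro heq
  rcases h.eq_or_eq_of_color hc heq (by rw [str_rev]) with h1 | h1
  · exact E.rev_ne d h1
  -- A loop through opposite sides would make the dart between them a fixed point of `fwd`. Its
  -- string would then be that single dart, which would have to start at an endpoint.
  · set e := E.face d with he
    have h2 : E.rot (E.rev d) = E.rev e := by rw [h1, rot_face]
    have h3 : E.fwd e = e := by
      rw [fwd_apply, ← h2]
      apply E.rot.injective
      rw [E.rot_four, he, rot_face]
    obtain ⟨x, hx, hcyc⟩ := E.arc e
    have : e = x := by
      have := (show SameCycle E.fwd e x from hcyc).eq_of_left h3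
      exact this
    have h4 : E.IsEnd e := by rw [this]; exact hx
    rw [he, isEnd_face] at h4
    exact h.not_isEnd_rev h4

theorem Regular.face_face_ne {d : D} (h : E.Regular (E.cell d)) : E.face (E.face d) ≠ d := by
  intro h2
  have hsub : {e | E.cell e = E.cell d} ⊆ ({d, E.face d} : Set D) := by
    intro e he
    rcases h.eq_or_of_cell_eq he with h1 | h1 | h1 | h1
    · simp [h1]
    · simp [h1]
    · simp [h1, h2]
    · simp [h1, h2]
  have h3 := Set.ncard_le_ncard hsub (Set.toFinite _)
  have h4 : ({d, E.face d} : Set D).ncard ≤ 2 :=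
    (Set.ncard_insert_le _ _).trans (by rw [Set.ncard_singleton])
  have h5 := h.2
  unfold degree at h5
  omega

end Regular

/-! ### Going straight on in the net -/

section Step
variable {D : Type*} (E : StringSystem D)

/-- The net-dart that continues a net-dart straight on. -/
def step : Equiv.Perm D := E.rev.trans (E.face.trans E.face)

theorem step_apply (d : D) : E.step d = E.face (E.face (E.rev d)) := rfl

variable {E}

theorem cell_step {d : D} (h : E.Regular (E.cell (E.rev d))) :
    E.cell (E.step d) = E.cell (E.rev d) := by
  have h1 : E.Regular (E.cell (E.face (E.rev d))) := by rwa [h.cell_face]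
  rw [step_apply, h1.cell_face, h.cell_face]

theorem step_rev_step [Finite D] {d : D} (h : E.Regular (E.cell (E.rev d))) :
    E.step (E.rev (E.step d)) = E.rev d := by
  rw [step_apply, E.rev_rev, step_apply, h.face_four]

theorem color_step [Finite D] {c : E.Str → Bool} (hc : E.IsBipartition c) {d : D}
    (h : E.Regular (E.cell (E.rev d))) : c (E.str (E.step d)) = c (E.str d) := by
  rw [step_apply, h.face_face_face hc, str_rev]

end Step

/-! ### Straight paths and their construction -/

section Paths
variable {D : Type*} {E : StringSystem D}

theorem IsStraight.getElem_succ {p : List D} (hp : E.IsStraight p) {i : ℕ} (hi : i + 1 < p.length) :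
    E.Regular (E.cell (E.rev p[i])) ∧ p[i + 1] = E.step p[i] :=
  List.isChain_iff_getElem.1 hp.2.2.2 i hi

theorem isInnerOf_iff {p : List D} {v : E.Cell} :
    E.IsInnerOf p v ↔ ∃ (i : ℕ) (h : i + 1 < p.length), v = E.cell (E.rev p[i]) := by
  constructor
  · rintro ⟨d, hd, rfl⟩
    obtain ⟨i, hi, rfl⟩ := List.getElem_of_mem hd
    rw [List.length_dropLast] at hi
    exact ⟨i, by omega, by rw [List.getElem_dropLast]⟩
  · rintro ⟨i, h, rfl⟩
    refine ⟨p[i], ?_, rfl⟩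
    rw [List.mem_iff_getElem]
    exact ⟨i, by rw [List.length_dropLast]; omega, by rw [List.getElem_dropLast]⟩

theorem IsStraight.regular_of_isInnerOf {p : List D} (hp : E.IsStraight p) {v : E.Cell}
    (h : E.IsInnerOf p v) : E.Regular v := by
  obtain ⟨i, hi, rfl⟩ := isInnerOf_iff.1 h
  exact (hp.getElem_succ hi).1

theorem IsStraight.isInnerOf_cell {p : List D} (hp : E.IsStraight p) {d : D} (hd : d ∈ p) :
    p.head? = some d ∨ E.IsInnerOf p (E.cell d) := by
  obtain ⟨i, hi, rfl⟩ := List.getElem_of_mem hd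
  rcases i with _ | i
  · left
    rw [List.head?_eq_getElem?, List.getElem?_eq_getElem hi]
  · right
    obtain ⟨h1, h2⟩ := hp.getElem_succ hi
    exact isInnerOf_iff.2 ⟨i, hi, by rw [h2, cell_step h1]⟩

theorem IsStraight.isInnerOf_cell_rev {p : List D} {d : D} (hd : d ∈ p) :
    p.getLast? = some d ∨ E.IsInnerOf p (E.cell (E.rev d)) := by
  obtain ⟨i, hi, rfl⟩ := List.getElem_of_mem hd
  by_cases h : i + 1 < p.length
  · exact Or.inr (isInnerOf_iff.2 ⟨i, h, rfl⟩)
  · left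
    have : i = p.length - 1 := by omega
    subst this
    rw [List.getLast?_eq_getElem?, List.getElem?_eq_getElem hi]

theorem IsStraight.isInnerOf_or_isEndOf {p : List D} (hp : E.IsStraight p) {v : E.Cell} {d : D}
    (hd : d ∈ p) (hv : E.Incident (E.edge d) v) : E.IsInnerOf p v ∨ E.IsEndOf p v := by
  obtain ⟨e, he, rfl⟩ := hv
  rcases (E.edge_eq_iff _ _).1 he with rfl | rfl
  · rcases hp.isInnerOf_cell hd with h | h
    · exact Or.inr (Or.inl ⟨d, h, rfl⟩)
    · exact Or.inl h
  · rcases IsStraight.isInnerOf_cell_rev (E := E) hd with h | h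
    · exact Or.inr (Or.inr ⟨_, h, by rw [E.rev_rev]⟩)
    · rw [E.rev_rev] at h
      exact Or.inl h

theorem IsInnerOf.touches {p : List D} {S : Finset (List D)} (hp : p ∈ S) {v : E.Cell}
    (h : E.IsInnerOf p v) : E.Touches S v := by
  obtain ⟨i, hi, rfl⟩ := isInnerOf_iff.1 h
  exact ⟨_, ⟨p, hp, p[i], List.getElem_mem _, rfl⟩, E.incident_cell_rev _⟩

theorem mem_edges_of_mem {S : Finset (List D)} {p : List D} (hp : p ∈ S) {d : D} (hd : d ∈ p) :
    E.edge d ∈ E.edges S := ⟨p, hp, d, hd, rfl⟩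

theorem IsStraight.color_eq [Finite D] {c : E.Str → Bool} (hc : E.IsBipartition c) {p : List D}
    (hp : E.IsStraight p) {d e : D} (hd : d ∈ p) (he : e ∈ p) :
    c (E.str d) = c (E.str e) := by
  have key : ∀ (i : ℕ) (hi : i < p.length),
      c (E.str p[i]) = c (E.str (p[0]'(Nat.zero_lt_of_lt hi))) := by
    intro i
    induction i with
    | zero => intro _; rfl
    | succ i ih =>
      intro hi
      obtain ⟨h1, h2⟩ := hp.getElem_succ hi
      rw [h2, color_step hc h1, ih]
  obtain ⟨i, hi, rfl⟩ := List.getElem_of_mem hd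
  obtain ⟨j, hj, rfl⟩ := List.getElem_of_mem he
  rw [key i hi, key j hj]

/-- From a non-border dart one can go straight on up to the first dart where one has to stop,
if one has to stop at the start, everywhere on holes, and with a dart also at the opposite one. -/
theorem exists_isStraight [Finite D] (St : D → Prop)
    (hreg : ∀ x, ¬ St x → E.Regular (E.cell x))
    (hopp : ∀ x, E.Regular (E.cell x) → St (E.face (E.face x)) → St x)
    {d : D} (hd : E.edge d ∉ E.border) (hst : St d) :
    ∃ p, E.IsStraight p ∧ p.head? = some d ∧ (∀ x ∈ p.dropLast, ¬ St (E.rev x)) ∧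
      ∀ x ∈ p.getLast?, St (E.rev x) := by
  classical
  -- A walk that is about to return to `d` arrives by the dart opposite to `d`, where `hopp` forces
  -- a stop. So the walk terminates and repeats no dart.
  have hret : ∀ k, 0 < k → E.step^[k] d = d → St (E.rev (E.step^[k - 1] d)) := by
    intro k hk h
    obtain ⟨k, rfl⟩ := Nat.exists_eq_succ_of_ne_zero hk.ne'
    by_contra h1
    rw [Nat.succ_sub_one] at h1
    refine h1 (hopp _ (hreg _ h1) ?_)
    rw [← E.step_apply, ← Function.iterate_succ_apply' (f := E.step), h]
    exact hst
  have hex : ∃ n, St (E.rev (E.step^[n] d)) := by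
    have hp : d ∈ Function.periodicPts E.step :=
      E.step.injective.mem_periodicPts d
    obtain ⟨k, hk, h⟩ := hp
    exact ⟨_, hret k hk h⟩
  let n := Nat.find hex
  have hn : St (E.rev (E.step^[n] d)) := Nat.find_spec hex
  have hlt : ∀ m < n, ¬ St (E.rev (E.step^[m] d)) := fun m hm => Nat.find_min hex hm
  have hinj : ∀ i j, i < j → j ≤ n → E.step^[j] d ≠ E.step^[i] d := by
    intro i j hij hj h
    have h1 : E.step^[j - i] d = d := by
      have h2 : E.step^[i] (E.step^[j - i] d) = E.step^[i] d := by
        rw [← Function.iterate_add_apply, Nat.add_sub_cancel' hij.le, h]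
      exact (E.step.injective.iterate i) h2
    exact hlt _ (by omega) (hret _ (by omega) h1)
  -- No edge is traversed in both directions: such a coincidence moves inward by one step at each
  -- end, until a dart equals its own reverse or, at a regular cell, its own opposite.
  have hrev : ∀ k i, i + k ≤ n → E.step^[i + k] d ≠ E.rev (E.step^[i] d) := by
    intro k
    induction k using Nat.strong_induction_on with
    | _ k ih =>
      intro i hi h
      rcases k with _ | _ | k
      · exact E.rev_ne _ h.symm
      · rw [zero_add, Function.iterate_succ_apply', E.step_apply] at h
        exact (hreg _ (hlt i (by omega))).face_face_ne h
      · refine ih k (by omega) (i + 1) (by omega) ?_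
        have h1 := step_rev_step (hreg _ (hlt (i + (k + 1)) (by omega)))
        rw [← Function.iterate_succ_apply' (f := E.step)] at h1
        have h3 : i + (k + 1) + 1 = i + (k + 1 + 1) := by omega
        rw [Nat.succ_eq_add_one, h3, h, E.rev_rev,
          ← Function.iterate_succ_apply' (f := E.step)] at h1
        rw [show i + 1 + k = i + (k + 1) by omega, h1, E.rev_rev]
  refine ⟨(List.range (n + 1)).map (fun i => E.step^[i] d), ⟨?_, ?_, ?_, ?_⟩, ?_, ?_, ?_⟩
  · simp
  · intro x hx
    obtain ⟨i, hi, rfl⟩ := List.mem_map.1 hx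
    rcases i with _ | i
    · exact hd
    · rw [List.mem_range] at hi
      have h1 := hreg _ (hlt i (by omega))
      apply Regular.edge_notMem_border
      rw [Function.iterate_succ_apply', cell_step h1]
      exact h1
  · rw [List.map_map]
    refine (List.nodup_map_iff_inj_on List.nodup_range).2 ?_
    have key : ∀ i j, i < j → j ≤ n → E.edge (E.step^[i] d) ≠ E.edge (E.step^[j] d) := by
      intro i j hij hj h
      rcases (E.edge_eq_iff _ _).1 h with h | h
      · exact hinj i j hij hj h
      · refine hrev (j - i) i (by omega) ?_
        rwa [Nat.add_sub_cancel' hij.le]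
    intro i hi j hj h
    rw [List.mem_range] at hi hj
    rcases lt_trichotomy i j with h1 | h1 | h1
    · exact absurd h (key i j h1 (by omega))
    · exact h1
    · exact absurd h.symm (key j i h1 (by omega))
  · rw [List.isChain_iff_getElem]
    intro i hi
    simp only [List.length_map, List.length_range] at hi
    simp only [List.getElem_map, List.getElem_range]
    exact ⟨hreg _ (hlt i (by omega)), by
      rw [Function.iterate_succ_apply', E.step_apply]⟩
  · simp [List.range_succ_eq_map]
  · intro x hx
    rw [List.range_succ, List.map_append, List.map_singleton, List.dropLast_concat] at hx
    obtain ⟨i, hi, rfl⟩ := List.mem_map.1 hx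
    exact hlt i (List.mem_range.1 hi)
  · intro x hx
    rw [List.range_succ, List.map_append, List.map_singleton, List.getLast?_concat] at hx
    cases hx
    exact hn

theorem exists_isShot [Finite D] (S : Finset (List D)) {d : D} (hd : E.edge d ∉ E.border)
    (hS : E.edge d ∉ E.edges S) (hv : ¬ E.Regular (E.cell d)) : ∃ p, E.IsShot S d p := by
  obtain ⟨p, h1, h2, h3, h4⟩ := exists_isStraight (E := E)
    (fun x => ¬ E.Regular (E.cell x) ∨ E.Touches S (E.cell x))
    (fun x hx => by by_contra h; exact hx (Or.inl h))
    (fun x hx h => by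
      have hx' : E.Regular (E.cell (E.face x)) := by rwa [hx.cell_face]
      rwa [hx'.cell_face, hx.cell_face] at h) hd (Or.inl hv)
  refine ⟨p, h1, h2, hS, ?_, h4⟩
  rintro v ⟨x, hx, rfl⟩ h
  exact h3 x hx (Or.inr h)

end Paths

/-! ### Saturation, shooting, and the potential along greedy runs -/

section Good
variable {D : Type*} {E : StringSystem D}

theorem IsCutSet.isInnerOf_of_touches {S : Finset (List D)} (hS : E.IsCutSet S) {v : E.Cell}
    (hv : E.Regular v) (h : E.Touches S v) : ∃ q ∈ S, E.IsInnerOf q v := by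
  obtain ⟨_, ⟨q, hq, d, hd, rfl⟩, hinc⟩ := h
  rcases (hS.1 q hq).isInnerOf_or_isEndOf hd hinc with h1 | h1
  · exact ⟨q, hq, h1⟩
  · rcases hS.2.2 q hq v h1 with h2 | ⟨r, hr, -, h2⟩
    · exact absurd hv h2
    · exact ⟨r, hr, h2⟩

/-- If a cut-set touches a regular vertex, one of its segments passes straight through. The two
opposite edges of that segment leave only angles of two squares. -/
theorem IsCutSet.saturates_of_regular [Finite D] {S : Finset (List D)} (hS : E.IsCutSet S)
    {v : E.Cell} (hv : E.Regular v) : E.Saturates (E.edges S) v := by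
  by_cases h : E.Touches S v
  · right
    obtain ⟨q, hq, hin⟩ := hS.isInnerOf_of_touches hv h
    obtain ⟨i, hi, rfl⟩ := isInnerOf_iff.1 hin
    obtain ⟨-, h2⟩ := (hS.1 q hq).getElem_succ hi
    set x := E.rev q[i] with hx
    have m1 : E.edge x ∈ E.edges S := by
      rw [hx, edge_rev]
      exact mem_edges_of_mem hq (List.getElem_mem _)
    have m2 : E.edge (E.face (E.face x)) ∈ E.edges S := by
      rw [hx, ← step_apply, ← h2]
      exact mem_edges_of_mem hq (List.getElem_mem _)
    intro d hd _
    rcases hv.eq_or_of_cell_eq hd with rfl | rfl | rfl | rfl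
    · exact Or.inl (Or.inl m1)
    · exact Or.inr (Or.inl m2)
    · exact Or.inl (Or.inl m2)
    · rw [hv.face_four]
      exact Or.inr (Or.inl m1)
  · exact Or.inl ⟨hv, fun e he heS => h ⟨e, heS, he⟩⟩

/-- Monotonicity fails at regular vertices, where no edge saturates but a single edge does not. -/
theorem Saturates.mono {X Y : Set E.Edge} {v : E.Cell} (h : E.Saturates X v)
    (hv : ¬ E.Regular v) (hXY : ∀ e, E.Incident e v → e ∈ X → e ∈ Y ∪ E.border) :
    E.Saturates Y v := by
  rcases h with h | h
  · exact absurd h.1 hv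
  · right
    have key : ∀ d, E.cell d = v → E.edge d ∈ X ∪ E.border → E.edge d ∈ Y ∪ E.border := by
      rintro d rfl (h1 | h1)
      · exact hXY _ (E.incident_cell d) h1
      · exact Or.inr h1
    intro d hd hend
    exact (h d hd hend).imp (key _ hd) (key _ ((E.cell_face hend).trans hd))

theorem relExp_spec [Finite D] (X : Set E.Edge) (v : E.Cell) :
    ∃ F : Finset E.Edge, (∀ e ∈ F, E.Incident e v) ∧ E.Saturates (X ∪ ↑F) v ∧
      F.card = E.relExp X v := by
  classical
  have := Fintype.ofFinite E.Edge
  refine Nat.sInf_mem (s := {k | ∃ F : Finset E.Edge, (∀ e ∈ F, E.Incident e v) ∧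
    E.Saturates (X ∪ ↑F) v ∧ F.card = k})
    ⟨_, Finset.univ.filter (fun e => E.Incident e v), ?_, ?_, rfl⟩
  · intro e he
    exact (Finset.mem_filter.1 he).2
  · right
    rintro d rfl -
    left; left; right
    simpa using E.incident_cell d

theorem relExp_le {X : Set E.Edge} {v : E.Cell} (F : Finset E.Edge)
    (hF : ∀ e ∈ F, E.Incident e v) (h : E.Saturates (X ∪ ↑F) v) : E.relExp X v ≤ F.card :=
  Nat.sInf_le ⟨F, hF, h, rfl⟩

theorem Saturates.relExp_eq_zero {X : Set E.Edge} {v : E.Cell} (h : E.Saturates X v) :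
    E.relExp X v = 0 :=
  Nat.le_zero.1 (relExp_le ∅ (by simp) (by simpa using h))

theorem saturates_of_relExp_eq_zero [Finite D] {X : Set E.Edge} {v : E.Cell}
    (h : E.relExp X v = 0) : E.Saturates X v := by
  obtain ⟨F, -, h2, h3⟩ := relExp_spec (E := E) X v
  rw [h, Finset.card_eq_zero] at h3
  simpa [h3] using h2

theorem relExp_anti [Finite D] {X Y : Set E.Edge} {v : E.Cell} (hv : ¬ E.Regular v)
    (hXY : X ⊆ Y) : E.relExp Y v ≤ E.relExp X v := by
  obtain ⟨F, h1, h2, h3⟩ := relExp_spec (E := E) X v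
  rw [← h3]
  refine relExp_le F h1 (h2.mono hv ?_)
  rintro e - (h | h)
  · exact Or.inl (Or.inl (hXY h))
  · exact Or.inl (Or.inr h)

theorem exponent_of_regular {v : E.Cell} (hv : E.Regular v) : E.exponent v = 0 :=
  Saturates.relExp_eq_zero (Or.inl ⟨hv, fun _ _ h => h⟩)

/-- A monochromatic cut-set is noncrossing. -/
theorem IsCutSet.isNoncrossing [Finite D] {c : E.Str → Bool} (hc : E.IsBipartition c)
    {S : Finset (List D)} (hS : E.IsCutSet S) (hm : E.IsMonochromatic c S) :
    E.IsNoncrossing S := by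
  obtain ⟨b, hb⟩ := hm
  intro p hp q hq hpq v h1 h2
  have hv := (hS.1 p hp).regular_of_isInnerOf h1
  obtain ⟨i, hi, rfl⟩ := isInnerOf_iff.1 h1
  obtain ⟨j, hj, hj2⟩ := isInnerOf_iff.1 h2
  obtain ⟨-, hi3⟩ := (hS.1 p hp).getElem_succ hi
  have hdis := hS.2.1 p hp q hq hpq
  rcases hv.eq_or_eq_of_color hc hj2.symm (by
    rw [str_rev, str_rev, hb p hp _ (List.getElem_mem _),
      hb q hq _ (List.getElem_mem _)]) with h | h
  · exact hdis _ (List.getElem_mem _) _ (List.getElem_mem _) (congrArg E.edge (E.rev.injective h.symm))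
  · rw [← step_apply, ← hi3] at h
    refine hdis _ (List.getElem_mem hi) _ (List.getElem_mem (Nat.lt_of_succ_lt hj)) ?_
    rw [← h, edge_rev]

theorem IsShot.notMem {S : Finset (List D)} {d : D} {p : List D} (h : E.IsShot S d p) : p ∉ S :=
  fun hp => h.2.2.1 (mem_edges_of_mem hp (List.mem_of_mem_head? h.2.1))

/-- Every edge of a shot after the first one starts at an inner vertex of the shot, which the old
segments do not touch. -/
theorem IsShot.edge_notMem {S : Finset (List D)} {d : D} {p : List D} (h : E.IsShot S d p)
    {x : D} (hx : x ∈ p) : E.edge x ∉ E.edges S := by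
  rcases h.1.isInnerOf_cell hx with h1 | h1
  · rw [h.2.1] at h1
    cases h1
    exact h.2.2.1
  · exact fun h2 => h.2.2.2.1 _ h1 ⟨_, h2, E.incident_cell x⟩

variable [DecidableEq D]

theorem edges_insert (p : List D) (S : Finset (List D)) :
    E.edges (insert p S) = {e | ∃ d ∈ p, E.edge d = e} ∪ E.edges S := by
  ext e
  simp [edges]

theorem IsShot.isCutSet {S : Finset (List D)} {d : D} {p : List D} (h : E.IsShot S d p)
    (hv : ¬ E.Regular (E.cell d)) (hS : E.IsCutSet S) : E.IsCutSet (insert p S) := by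
  refine ⟨?_, ?_, ?_⟩
  · intro q hq
    rcases Finset.mem_insert.1 hq with rfl | hq
    · exact h.1
    · exact hS.1 q hq
  · intro q hq r hr hqr x hx y hy hxy
    rcases Finset.mem_insert.1 hq with rfl | hq' <;> rcases Finset.mem_insert.1 hr with rfl | hr'
    · exact hqr rfl
    · exact h.edge_notMem hx (hxy ▸ mem_edges_of_mem hr' hy)
    · exact h.edge_notMem hy (hxy ▸ mem_edges_of_mem hq' hx)
    · exact hS.2.1 q hq' r hr' hqr x hx y hy hxy
  · intro q hq v hend
    rcases Finset.mem_insert.1 hq with rfl | hq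
    · rcases hend with ⟨x, hx, rfl⟩ | ⟨x, hx, rfl⟩
      · rw [h.2.1] at hx
        cases hx
        exact Or.inl hv
      · rcases h.2.2.2.2 x hx with h1 | h1
        · exact Or.inl h1
        · by_cases hreg : E.Regular (E.cell (E.rev x))
          -- A shot may stop at a regular vertex on an old segment, perhaps at an end of it. The
          -- cut-set condition on the old set then supplies a segment passing through.
          · obtain ⟨r, hr, hin⟩ := hS.isInnerOf_of_touches hreg h1
            exact Or.inr ⟨r, Finset.mem_insert_of_mem hr,
              fun he => h.notMem (he ▸ hr), hin⟩
          · exact Or.inl hreg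
    · rcases hS.2.2 q hq v hend with h1 | ⟨r, hr, h1⟩
      · exact Or.inl h1
      · exact Or.inr ⟨r, Finset.mem_insert_of_mem hr, h1⟩

theorem IsShot.isNoncrossing {S : Finset (List D)} {d : D} {p : List D} (h : E.IsShot S d p)
    (hS : E.IsNoncrossing S) : E.IsNoncrossing (insert p S) := by
  intro q hq r hr hqr v h1 h2
  rcases Finset.mem_insert.1 hq with rfl | hq' <;> rcases Finset.mem_insert.1 hr with rfl | hr'
  · exact hqr rfl
  · exact h.2.2.2.1 v h1 (h2.touches hr')
  · exact h.2.2.2.1 v h2 (h1.touches hq')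
  · exact hS q hq' r hr' hqr v h1 h2

theorem Shoots.edges_subset {v : E.Cell} {S S' : Finset (List D)} {n : ℕ}
    (h : E.Shoots v S n S') : E.edges S ⊆ E.edges S' := by
  induction h with
  | nil S => exact subset_rfl
  | cons hv hp h ih =>
    refine subset_trans ?_ ih
    rw [edges_insert]
    exact Set.subset_union_right

theorem Shoots.good {v : E.Cell} (hv : ¬ E.Regular v) {S S' : Finset (List D)} {n : ℕ}
    (h : E.Shoots v S n S') (h1 : E.IsCutSet S) (h2 : E.IsNoncrossing S) :
    E.IsCutSet S' ∧ E.IsNoncrossing S' ∧ S'.card = S.card + n := by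
  induction h with
  | nil S => exact ⟨h1, h2, rfl⟩
  | cons hd hp h ih =>
    obtain ⟨a, b, e⟩ := ih (hp.isCutSet (hd ▸ hv) h1) (hp.isNoncrossing h2)
    refine ⟨a, b, ?_⟩
    rw [e, Finset.card_insert_of_notMem hp.notMem]
    omega

/-- Only an inequality holds for the number of shots: a border edge needs none, and a shot may
return to `v` and cover a second edge of `F`. -/
theorem exists_shoots [Finite D] {v : E.Cell} (hv : ¬ E.Regular v) (F : Finset E.Edge)
    (hF : ∀ e ∈ F, E.Incident e v) (S : Finset (List D)) :
    ∃ n ≤ F.card, ∃ S', E.Shoots v S n S' ∧ ∀ e ∈ F, e ∈ E.edges S' ∪ E.border := by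
  classical
  induction F using Finset.induction_on generalizing S with
  | empty => exact ⟨0, le_rfl, S, Shoots.nil S, by simp⟩
  | insert e F he ih =>
    have hF' : ∀ e ∈ F, E.Incident e v := fun e h => hF e (Finset.mem_insert_of_mem h)
    rw [Finset.card_insert_of_notMem he]
    by_cases hcov : e ∈ E.edges S ∪ E.border
    · obtain ⟨n, hn, S', h1, h2⟩ := ih hF' S
      refine ⟨n, by omega, S', h1, fun x hx => ?_⟩
      rcases Finset.mem_insert.1 hx with rfl | hx
      · exact hcov.imp (fun h => h1.edges_subset h) id
      · exact h2 x hx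
    · obtain ⟨d, rfl, rfl⟩ := hF e (Finset.mem_insert_self _ _)
      obtain ⟨p, hp⟩ := exists_isShot (E := E) S (fun h => hcov (Or.inr h))
        (fun h => hcov (Or.inl h)) hv
      obtain ⟨n, hn, S', h1, h2⟩ := ih hF' (insert p S)
      refine ⟨n + 1, by omega, S', Shoots.cons rfl hp h1, fun x hx => ?_⟩
      rcases Finset.mem_insert.1 hx with rfl | hx
      · exact Or.inl (h1.edges_subset
          (mem_edges_of_mem (Finset.mem_insert_self _ _) (List.mem_of_mem_head? hp.2.1)))
      · exact h2 x hx

theorem exists_shoots_saturates [Finite D] {v : E.Cell} (hv : ¬ E.Regular v)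
    (S : Finset (List D)) :
    ∃ n ≤ E.relExp (E.edges S) v, ∃ S', E.Shoots v S n S' ∧ E.Saturates (E.edges S') v := by
  obtain ⟨F, h1, h2, h3⟩ := relExp_spec (E := E) (E.edges S) v
  obtain ⟨n, hn, S', h4, h5⟩ := exists_shoots hv F h1 S
  refine ⟨n, h3 ▸ hn, S', h4, h2.mono hv ?_⟩
  rintro e - (h | h)
  · exact Or.inl (h4.edges_subset h)
  · exact h5 e h

theorem exists_greedyStep [Finite D] {v : E.Cell} (hv : ¬ E.Regular v) (S : Finset (List D)) :
    ∃ S', E.GreedyStep v S S' := by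
  classical
  have hex : ∃ n, ∃ S', E.Shoots v S n S' ∧ E.Saturates (E.edges S') v := by
    obtain ⟨n, -, S', h⟩ := exists_shoots_saturates hv S
    exact ⟨n, S', h⟩
  obtain ⟨S', h1, h2⟩ := Nat.find_spec hex
  exact ⟨S', _, h1, h2, fun m S'' h3 h4 => Nat.find_min' hex ⟨S'', h3, h4⟩⟩

theorem exists_greedy [Finite D] (vs : List E.Cell) (hvs : ∀ v ∈ vs, ¬ E.Regular v)
    (S : Finset (List D)) : ∃ S', E.Greedy vs S S' := by
  induction vs generalizing S with
  | nil => exact ⟨S, Greedy.nil S⟩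
  | cons v vs ih =>
    obtain ⟨S', h⟩ := exists_greedyStep (hvs v List.mem_cons_self) S
    obtain ⟨S'', h2⟩ := ih (fun w hw => hvs w (List.mem_cons_of_mem _ hw)) S'
    exact ⟨S'', Greedy.cons h h2⟩

/-- The potential |S| + ∑ exp_S does not increase: the shots are paid for by the exponent of `v`,
which drops to zero. -/
theorem GreedyStep.spec [Finite D] {v : E.Cell} (hv : ¬ E.Regular v) {S S' : Finset (List D)}
    (h : E.GreedyStep v S S') (h1 : E.IsCutSet S) (h2 : E.IsNoncrossing S) :
    E.IsCutSet S' ∧ E.IsNoncrossing S' ∧ E.edges S ⊆ E.edges S' ∧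
      E.Saturates (E.edges S') v ∧
      S'.card + ∑ w : E.Cell, E.relExp (E.edges S') w ≤
        S.card + ∑ w : E.Cell, E.relExp (E.edges S) w := by
  classical
  obtain ⟨n, hsh, hsat, hmin⟩ := h
  obtain ⟨hcut, hnc, hcard⟩ := hsh.good hv h1 h2
  obtain ⟨m, hm, T, hT1, hT2⟩ := exists_shoots_saturates hv S
  have hn : n ≤ E.relExp (E.edges S) v := (hmin m T hT1 hT2).trans hm
  refine ⟨hcut, hnc, hsh.edges_subset, hsat, ?_⟩
  rw [← Finset.add_sum_erase _ _ (Finset.mem_univ v),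
    ← Finset.add_sum_erase (a := v) _ (fun w => E.relExp (E.edges S) w) (Finset.mem_univ v),
    hsat.relExp_eq_zero, hcard]
  have : ∑ w ∈ Finset.univ.erase v, E.relExp (E.edges S') w ≤
      ∑ w ∈ Finset.univ.erase v, E.relExp (E.edges S) w := by
    refine Finset.sum_le_sum fun w _ => ?_
    by_cases hw : E.Regular w
    · rw [(hcut.saturates_of_regular hw).relExp_eq_zero]
      exact Nat.zero_le _
    · exact relExp_anti hw hsh.edges_subset
  omega

theorem Greedy.spec [Finite D] {vs : List E.Cell} {S S' : Finset (List D)}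
    (h : E.Greedy vs S S') (hvs : ∀ v ∈ vs, ¬ E.Regular v)
    (h1 : E.IsCutSet S) (h2 : E.IsNoncrossing S) :
    E.IsCutSet S' ∧ E.IsNoncrossing S' ∧ E.edges S ⊆ E.edges S' ∧
      (∀ v ∈ vs, E.Saturates (E.edges S') v) ∧
      S'.card + ∑ w : E.Cell, E.relExp (E.edges S') w ≤
        S.card + ∑ w : E.Cell, E.relExp (E.edges S) w := by
  induction h with
  | nil S => exact ⟨h1, h2, subset_rfl, by simp, le_rfl⟩
  | @cons v vs S S' S'' hstep h ih =>
    have hv := hvs v List.mem_cons_self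
    obtain ⟨a1, a2, a3, a4, a5⟩ := hstep.spec hv h1 h2
    obtain ⟨b1, b2, b3, b4, b5⟩ := ih (fun w hw => hvs w (List.mem_cons_of_mem _ hw)) a1 a2
    refine ⟨b1, b2, a3.trans b3, ?_, b5.trans a5⟩
    intro w hw
    rcases List.mem_cons.1 hw with rfl | hw
    · exact a4.mono hv fun e _ he => Or.inl (b3 he)
    · exact b4 w hw

end Good

/-! ### The local estimate at a vertex on a hole -/

section Local
variable {D : Type*} {E : StringSystem D}

/-- A dart on which the boundary walk of its cell ends is reached from every dart of the cell. -/
theorem reaches_of_isEnd_rev {z : D} (hz : E.IsEnd (E.rev z)) {d : D} (h : E.cell d = E.cell z) :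
    Relation.ReflTransGen (fun x y => ¬ E.IsEnd (E.rev x) ∧ y = E.face x) d z := by
  refine (iff_of_cell_eq (E := E)
    (P := fun x => Relation.ReflTransGen (fun x y => ¬ E.IsEnd (E.rev x) ∧ y = E.face x) x z)
    ?_ h).2 Relation.ReflTransGen.refl
  intro x hx
  constructor
  · intro h1
    rcases Relation.ReflTransGen.cases_head h1 with rfl | ⟨y, ⟨-, rfl⟩, h2⟩
    · exact absurd hz hx
    · exact h2
  · exact fun h1 => Relation.ReflTransGen.head ⟨hx, rfl⟩ h1

/-- The boundary walk of a cell stops at most once, because from every dart of the cell it reaches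
every stopping dart. -/
theorem eq_of_isEnd_rev {y z : D} (hy : E.IsEnd (E.rev y)) (hz : E.IsEnd (E.rev z))
    (h : E.cell y = E.cell z) : y = z := by
  rcases Relation.ReflTransGen.cases_head (reaches_of_isEnd_rev hz h) with h1 | ⟨_, ⟨h1, -⟩, -⟩
  · exact h1
  · exact absurd hy h1

variable [Fintype D]

open Classical in
/-- The darts of the non-border edges at a cell. -/
noncomputable def innerDarts (E : StringSystem D) (v : E.Cell) : Finset D :=
  Finset.univ.filter fun d => E.cell d = v ∧ E.edge d ∉ E.border

theorem mem_innerDarts {v : E.Cell} {d : D} :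
    d ∈ E.innerDarts v ↔ E.cell d = v ∧ E.edge d ∉ E.border := by
  simp [innerDarts]

open Classical in
/-- The edges of one color at a cell saturate it. -/
theorem relExp_le_card_color {c : E.Str → Bool} (hc : E.IsBipartition c) (X : Set E.Edge)
    (v : E.Cell) (b : Bool) :
    E.relExp X v ≤
      ((E.innerDarts v).filter fun d => c (E.str d) = b ∧ E.edge d ∉ X).card := by
  refine (relExp_le (((E.innerDarts v).filter fun d => c (E.str d) = b ∧ E.edge d ∉ X).image E.edge)
    ?_ ?_).trans Finset.card_image_le
  · intro e he
    obtain ⟨d, hd, rfl⟩ := Finset.mem_image.1 he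
    rw [← (mem_innerDarts.1 (Finset.mem_filter.1 hd).1).1]
    exact E.incident_cell d
  · right
    have key : ∀ d, E.cell d = v → c (E.str d) = b → E.edge d ∈ X ∪
        ↑(((E.innerDarts v).filter fun d => c (E.str d) = b ∧ E.edge d ∉ X).image E.edge) ∪
          E.border := by
      intro d hd hb
      by_cases h1 : E.edge d ∈ E.border
      · exact Or.inr h1
      · by_cases h2 : E.edge d ∈ X
        · exact Or.inl (Or.inl h2)
        · exact Or.inl (Or.inr (Finset.mem_coe.2 (Finset.mem_image_of_mem _
            (Finset.mem_filter.2 ⟨mem_innerDarts.2 ⟨hd, h1⟩, hb, h2⟩))))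
    intro d hd hend
    by_cases hb : c (E.str d) = b
    · exact Or.inl (key d hd hb)
    · refine Or.inr (key _ ((E.cell_face hend).trans hd) ?_)
      rw [hc.face hend]
      cases b <;> simpa using hb

open Classical in
/-- A saturating set covers at least half of the non-border darts at a cell on a hole, or exactly
those of one color. -/
theorem Saturates.half_or_color {c : E.Str → Bool} (hc : E.IsBipartition c) {X : Set E.Edge}
    {v : E.Cell} (hv : ¬ E.Regular v) (h : E.Saturates X v) :
    (E.innerDarts v).card ≤ 2 * ((E.innerDarts v).filter fun d => E.edge d ∈ X).card ∨
      ∃ b, ∀ d ∈ E.innerDarts v, E.edge d ∈ X ↔ c (E.str d) = b := by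
  have hsat := h.resolve_left fun h => hv h.1
  set C := (E.innerDarts v).filter fun d => E.edge d ∈ X with hC
  set U := (E.innerDarts v).filter fun d => E.edge d ∉ X with hU
  have hcard : (E.innerDarts v).card = C.card + U.card :=
    (Finset.card_filter_add_card_filter_not _).symm
  have hend : ∀ d ∈ E.innerDarts v, ¬ E.IsEnd (E.rev d) := fun d hd h =>
    (mem_innerDarts.1 hd).2 ((E.edge_mem_border_iff d).2 (Or.inr h))
  -- Two consecutive uncovered non-border darts would violate saturation, so the successor of an
  -- uncovered dart is covered or is the border dart that ends the walk.
  have hface : ∀ d ∈ U, E.face d ∈ C ∨ E.IsEnd (E.rev (E.face d)) := by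
    intro d hd
    obtain ⟨h1, h2⟩ := Finset.mem_filter.1 hd
    have h3 := hend d h1
    have hcell := (E.cell_face h3).trans (mem_innerDarts.1 h1).1
    by_cases hb : E.edge (E.face d) ∈ E.border
    · right
      refine ((E.edge_mem_border_iff _).1 hb).resolve_left ?_
      rwa [isEnd_face]
    · left
      refine Finset.mem_filter.2 ⟨mem_innerDarts.2 ⟨hcell, hb⟩, ?_⟩
      rcases hsat d (mem_innerDarts.1 h1).1 h3 with h4 | h4
      · rcases h4 with h4 | h4
        · exact absurd h4 h2
        · exact absurd h4 (mem_innerDarts.1 h1).2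
      · exact h4.resolve_right hb
  by_cases hz : ∃ z, E.cell z = v ∧ E.IsEnd (E.rev z)
  swap
  · left
    have : U.card ≤ C.card := by
      refine Finset.card_le_card_of_injOn E.face ?_ E.face.injective.injOn
      intro d hd
      refine (hface d hd).resolve_right fun h1 => hz ⟨_, ?_, h1⟩
      have h2 := (Finset.mem_filter.1 hd).1
      exact (E.cell_face (hend d h2)).trans (mem_innerDarts.1 h2).1
    omega
  obtain ⟨z, hzv, hz⟩ := hz
  by_cases hle : (E.innerDarts v).card ≤ 2 * C.card
  · exact Or.inl hle
  right
  -- Only the dart `y` just before the end of the walk can lack a covered successor.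
  set y := E.face.symm z with hy
  have hyz : E.face y = z := E.face.apply_symm_apply z
  have hmaps : ∀ d ∈ U.erase y, E.face d ∈ C := by
    intro d hd
    obtain ⟨h1, h2⟩ := Finset.mem_erase.1 hd
    refine (hface d h2).resolve_right fun h3 => h1 ?_
    have h4 := (Finset.mem_filter.1 h2).1
    apply E.face.injective
    rw [hyz]
    exact eq_of_isEnd_rev h3 hz
      (((E.cell_face (hend d h4)).trans (mem_innerDarts.1 h4).1).trans hzv.symm)
  have hle2 : (U.erase y).card ≤ C.card :=
    Finset.card_le_card_of_injOn E.face hmaps E.face.injective.injOn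
  have hyU : y ∈ U := by
    by_contra hyU
    rw [Finset.erase_eq_of_notMem hyU] at hle2
    omega
  -- If fewer than half are covered, there is exactly one more uncovered than covered dart, so every
  -- covered dart follows an uncovered one and coverage strictly alternates.
  have hsurj : ∀ e ∈ C, ∃ d ∈ U, E.face d = e := by
    have himg : (U.erase y).image E.face = C := by
      refine Finset.eq_of_subset_of_card_le (Finset.image_subset_iff.2 hmaps) ?_
      rw [Finset.card_image_of_injective _ E.face.injective, Finset.card_erase_of_mem hyU]
      omega
    intro e he
    rw [← himg] at he
    obtain ⟨d, hd, rfl⟩ := Finset.mem_image.1 he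
    exact ⟨d, Finset.mem_of_mem_erase hd, rfl⟩
  refine ⟨c (E.str z), ?_⟩
  -- Induction backwards from the border dart `z`: its predecessor is uncovered and of the other
  -- color, and further back coverage and color switch together.
  have key : ∀ d, Relation.ReflTransGen (fun x y => ¬ E.IsEnd (E.rev x) ∧ y = E.face x) d z →
      d ∈ E.innerDarts v → (E.edge d ∈ X ↔ c (E.str d) = c (E.str z)) := by
    intro d hd
    induction hd using Relation.ReflTransGen.head_induction_on with
    | refl => exact fun h1 => absurd hz (hend z h1)
    | head h1 _ ih =>
      rename_i x w _
      obtain ⟨hx, rfl⟩ := h1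
      intro hxm
      have hcell := (E.cell_face hx).trans (mem_innerDarts.1 hxm).1
      have hcol := hc.face hx
      by_cases hb : E.edge (E.face x) ∈ E.border
      · have h2 : E.IsEnd (E.rev (E.face x)) := by
          refine ((E.edge_mem_border_iff _).1 hb).resolve_left ?_
          rwa [isEnd_face]
        have h3 := eq_of_isEnd_rev h2 hz (hcell.trans hzv.symm)
        have h4 : x = y := E.face.injective (h3.trans hyz.symm)
        have h5 : E.edge x ∉ X := by
          rw [h4]
          exact (Finset.mem_filter.1 hyU).2
        rw [← h3, hcol]
        simp [h5]
      · have hm : E.face x ∈ E.innerDarts v := mem_innerDarts.2 ⟨hcell, hb⟩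
        have h2 := ih hm
        rw [hcol] at h2
        have h3 : E.edge x ∈ X ↔ E.edge (E.face x) ∉ X := by
          constructor
          · intro h4 h5
            obtain ⟨d, hd, hd2⟩ := hsurj _ (Finset.mem_filter.2 ⟨hm, h5⟩)
            rw [E.face.injective hd2] at hd
            exact (Finset.mem_filter.1 hd).2 h4
          · intro h4
            rcases hsat x (mem_innerDarts.1 hxm).1 hx with h5 | h5
            · exact h5.resolve_right (mem_innerDarts.1 hxm).2
            · rcases h5 with h5 | h5
              · exact absurd h5 h4
              · exact absurd h5 hb
        rw [h3, h2]
        cases c (E.str x) <;> cases c (E.str z) <;> simp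
  intro d hd
  exact key d (reaches_of_isEnd_rev hz ((mem_innerDarts.1 hd).1.trans hzv.symm)) hd

open Classical in
/-- At a cell on a hole, the exponents relative to a blue and to a red part of a saturating set. -/
theorem Saturates.relExp_add_relExp_le {c : E.Str → Bool} (hc : E.IsBipartition c) {X : Set E.Edge}
    {v : E.Cell} (hv : ¬ E.Regular v) (h : E.Saturates X v) (Y : Bool → Set E.Edge)
    (hYX : ∀ b, Y b ⊆ X) (hY : ∀ b d, E.edge d ∈ Y b → c (E.str d) = b) :
    E.relExp (Y true) v + E.relExp (Y false) v +
        ((E.innerDarts v).filter fun d => ∃ b, E.edge d ∈ Y b).card ≤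
      2 * ((E.innerDarts v).filter fun d => E.edge d ∈ X).card := by
  set N := E.innerDarts v with hN
  have hsplit : ∀ b b', (N.filter fun d => c (E.str d) = b ∧ E.edge d ∈ Y b').card +
      (N.filter fun d => c (E.str d) = b ∧ E.edge d ∉ Y b').card =
        (N.filter fun d => c (E.str d) = b).card := by
    intro b b'
    rw [← Finset.filter_filter, ← Finset.filter_filter]
    exact Finset.card_filter_add_card_filter_not _
  -- With at least half covered, each `Y b` is completed by the remaining darts of its own color b.
  rcases h.half_or_color hc hv with h1 | ⟨b, hb⟩
  · have h2 : (N.filter fun d => ∃ b, E.edge d ∈ Y b).card ≤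
        (N.filter fun d => c (E.str d) = true ∧ E.edge d ∈ Y true).card +
        (N.filter fun d => c (E.str d) = false ∧ E.edge d ∈ Y false).card := by
      refine (Finset.card_le_card ?_).trans (Finset.card_union_le _ _)
      intro d hd
      obtain ⟨hd1, b, hd2⟩ := Finset.mem_filter.1 hd
      have := hY b d hd2
      cases b
      · exact Finset.mem_union_right _ (Finset.mem_filter.2 ⟨hd1, this, hd2⟩)
      · exact Finset.mem_union_left _ (Finset.mem_filter.2 ⟨hd1, this, hd2⟩)
    have h3 : (N.filter fun d => c (E.str d) = true).card +
        (N.filter fun d => c (E.str d) = false).card = N.card := by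
      rw [← Finset.card_filter_add_card_filter_not (s := N) (fun d => c (E.str d) = true)]
      simp only [Bool.not_eq_true]
    have h4 := relExp_le_card_color hc (Y true) v true
    have h5 := relExp_le_card_color hc (Y false) v false
    have h6 := hsplit true true
    have h7 := hsplit false false
    rw [← hN] at h1 h4 h5
    omega
  · have hC : (N.filter fun d => E.edge d ∈ X) = N.filter fun d => c (E.str d) = b :=
      Finset.filter_congr hb
    have h2 : (N.filter fun d => ∃ b, E.edge d ∈ Y b).card ≤
        (N.filter fun d => c (E.str d) = b ∧ E.edge d ∈ Y b).card := by
      refine Finset.card_le_card ?_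
      intro d hd
      obtain ⟨hd1, b', hd2⟩ := Finset.mem_filter.1 hd
      have h3 := hY b' d hd2
      have h4 := (hb d hd1).1 (hYX _ hd2)
      rw [h3] at h4
      subst h4
      exact Finset.mem_filter.2 ⟨hd1, h3, hd2⟩
    -- If exactly color b is covered, both sets are completed with color b; the other one, `Y (!b)`,
    -- has no edge at `v`.
    have h4 := relExp_le_card_color hc (Y b) v b
    have h5 := relExp_le_card_color hc (Y (!b)) v b
    have h6 := hsplit b b
    have h7 := hsplit b (!b)
    rw [hC]
    rw [← hN] at h4 h5
    cases b <;> simp only [Bool.not_true, Bool.not_false] at * <;> omega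

end Local

/-! ### Global count of segment ends on holes -/

section Count
variable {D : Type*} [Fintype D] {E : StringSystem D}

open Classical in
/-- The darts that leave a hole through an edge of `X`. -/
noncomputable def holeDarts (E : StringSystem D) (X : Set E.Edge) : Finset D :=
  Finset.univ.filter fun d => E.edge d ∈ X ∧ ¬ E.Regular (E.cell d)

theorem mem_holeDarts {X : Set E.Edge} {d : D} :
    d ∈ E.holeDarts X ↔ E.edge d ∈ X ∧ ¬ E.Regular (E.cell d) := by
  simp [holeDarts]

/-- Inner vertices of straight paths are regular, so a path can meet a hole only at its ends. -/
theorem exists_end_of_mem_holeDarts {S : Finset (List D)} (hS : ∀ p ∈ S, E.IsStraight p) {d : D}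
    (hd : d ∈ E.holeDarts (E.edges S)) :
    ∃ p ∈ S, p.head? = some d ∨ p.getLast? = some (E.rev d) := by
  obtain ⟨⟨p, hp, x, hx, hxd⟩, hreg⟩ := mem_holeDarts.1 hd
  refine ⟨p, hp, ?_⟩
  rcases (E.edge_eq_iff _ _).1 hxd with rfl | rfl
  · exact ((hS p hp).isInnerOf_cell hx).imp_right
      fun h => absurd ((hS p hp).regular_of_isInnerOf h) hreg
  · right
    rw [E.rev_rev]
    exact (IsStraight.isInnerOf_cell_rev (E := E) hx).resolve_right
      fun h => hreg ((hS p hp).regular_of_isInnerOf h)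

theorem card_holeDarts_le {S : Finset (List D)} (hS : ∀ p ∈ S, E.IsStraight p) :
    (E.holeDarts (E.edges S)).card ≤ 2 * S.card := by
  classical
  rw [← Finset.card_image_of_injective _ (Option.some_injective D), two_mul]
  refine (Finset.card_le_card (t := S.image (fun p => p.head?) ∪
    S.image (fun p => p.getLast?.map E.rev)) ?_).trans
    ((Finset.card_union_le _ _).trans (add_le_add Finset.card_image_le Finset.card_image_le))
  intro o ho
  obtain ⟨d, hd, rfl⟩ := Finset.mem_image.1 ho
  obtain ⟨p, hp, h | h⟩ := exists_end_of_mem_holeDarts hS hd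
  · exact Finset.mem_union_left _ (Finset.mem_image.2 ⟨p, hp, h⟩)
  · exact Finset.mem_union_right _ (Finset.mem_image.2 ⟨p, hp, by simp [h, E.rev_rev]⟩)

/-- A segment outside `F` has a regular end, so it contributes at most one hole dart. -/
theorem card_holeDarts_le_of_subset {S F : Finset (List D)} (hFS : F ⊆ S)
    (hS : ∀ p ∈ S, E.IsStraight p)
    (hF : ∀ p ∈ S, p ∉ F → ∃ v, E.IsEndOf p v ∧ E.Regular v) :
    (E.holeDarts (E.edges S)).card + F.card ≤ (E.holeDarts (E.edges F)).card + S.card := by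
  classical
  have hle : (E.holeDarts (E.edges S) \ E.holeDarts (E.edges F)).card ≤ (S \ F).card := by
    rw [← Finset.card_image_of_injective _ (Option.some_injective D)]
    -- Each segment outside `F` is sent to the dart at its only possible hole end: the last one,
    -- reversed, if the first vertex is regular, otherwise the first.
    refine (Finset.card_le_card (t := (S \ F).image (fun p =>
      if ∀ d ∈ p.head?, E.Regular (E.cell d) then p.getLast?.map E.rev else p.head?)) ?_).trans
      Finset.card_image_le
    intro o ho
    obtain ⟨d, hd, rfl⟩ := Finset.mem_image.1 ho
    obtain ⟨hd1, hd2⟩ := Finset.mem_sdiff.1 hd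
    have hreg := (mem_holeDarts.1 hd1).2
    obtain ⟨p, hp, h⟩ := exists_end_of_mem_holeDarts hS hd1
    have hpF : p ∉ F := by
      intro hpF
      refine hd2 (mem_holeDarts.2 ⟨?_, hreg⟩)
      rcases h with h | h
      · exact mem_edges_of_mem hpF (List.mem_of_mem_head? h)
      · rw [← edge_rev]
        exact mem_edges_of_mem hpF (List.mem_of_mem_getLast? h)
    refine Finset.mem_image.2 ⟨p, Finset.mem_sdiff.2 ⟨hp, hpF⟩, ?_⟩
    rcases h with h | h
    · rw [if_neg (by simpa [h] using hreg), h]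
    · rw [if_pos, h]
      · simp [E.rev_rev]
      · obtain ⟨v, ⟨x, hx, rfl⟩ | ⟨x, hx, rfl⟩, hv⟩ := hF p hp hpF
        · intro y hy
          rw [Option.mem_def] at hx hy
          rw [hx] at hy
          cases hy
          exact hv
        · rw [h] at hx
          cases hx
          rw [E.rev_rev] at hv
          exact absurd hv hreg
  have h1 := Finset.card_le_card (show E.holeDarts (E.edges S) ⊆
    (E.holeDarts (E.edges S) \ E.holeDarts (E.edges F)) ∪ E.holeDarts (E.edges F) by
      intro d hd
      by_cases h : d ∈ E.holeDarts (E.edges F)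
      · exact Finset.mem_union_right _ h
      · exact Finset.mem_union_left _ (Finset.mem_sdiff.2 ⟨hd, h⟩))
  have h2 := Finset.card_union_le (E.holeDarts (E.edges S) \ E.holeDarts (E.edges F))
    (E.holeDarts (E.edges F))
  have h3 := Finset.card_sdiff_add_card_eq_card hFS
  omega

/-- Among the segments of a saturating cut-set, those of one color with both ends on holes. -/
theorem exists_monochromatic {c : E.Str → Bool} (hc : E.IsBipartition c) {S : Finset (List D)}
    (hS : E.IsCutSet S) (hsat : ∀ v, E.Saturates (E.edges S) v) :
    ∃ B : Bool → Finset (List D), (∀ b, E.IsCutSet (B b) ∧ E.IsMonochromatic c (B b)) ∧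
      ((B true).card + ∑ v : E.Cell, E.relExp (E.edges (B true)) v) +
        ((B false).card + ∑ v : E.Cell, E.relExp (E.edges (B false)) v) ≤ 3 * S.card := by
  classical
  -- Segments with both ends on holes rely on no other segment, so any subset of them is again a
  -- cut-set.
  set full : List D → Prop := fun p => ∀ v, E.IsEndOf p v → ¬ E.Regular v with hfull
  set B : Bool → Finset (List D) := fun b =>
    S.filter fun p => full p ∧ ∀ d ∈ p, c (E.str d) = b with hB
  have hBS : ∀ b, B b ⊆ S := fun b => Finset.filter_subset _ _
  have hBcut : ∀ b, E.IsCutSet (B b) := fun b =>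
    ⟨fun p hp => hS.1 p (hBS b hp), fun p hp q hq => hS.2.1 p (hBS b hp) q (hBS b hq),
      fun p hp v hv => Or.inl ((Finset.mem_filter.1 hp).2.1 v hv)⟩
  refine ⟨B, fun b => ⟨hBcut b, b, fun p hp => (Finset.mem_filter.1 hp).2.2⟩, ?_⟩
  set F := B true ∪ B false with hF
  have hFS : F ⊆ S := Finset.union_subset (hBS _) (hBS _)
  have hBF : ∀ b, B b ⊆ F := by
    rintro (_ | _)
    · exact Finset.subset_union_right
    · exact Finset.subset_union_left
  have hFcard : F.card = (B true).card + (B false).card := by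
    refine Finset.card_union_of_disjoint (Finset.disjoint_left.2 fun p h1 h2 => ?_)
    obtain ⟨d, hd⟩ := List.exists_mem_of_ne_nil p (hS.1 p (hBS _ h1)).1
    have h3 := (Finset.mem_filter.1 h1).2.2 d hd
    have h4 := (Finset.mem_filter.1 h2).2.2 d hd
    rw [h3] at h4
    cases h4
  have hnotF : ∀ p ∈ S, p ∉ F → ∃ v, E.IsEndOf p v ∧ E.Regular v := by
    intro p hp hpF
    by_contra hcon
    push Not at hcon
    obtain ⟨d, hd⟩ := List.exists_mem_of_ne_nil p (hS.1 p hp).1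
    exact hpF (hBF (c (E.str d)) (Finset.mem_filter.2
      ⟨hp, hcon, fun e he => (hS.1 p hp).color_eq hc he hd⟩))
  have hedgesF : ∀ e, e ∈ E.edges F ↔ ∃ b, e ∈ E.edges (B b) := by
    intro e
    constructor
    · rintro ⟨p, hp, d, hd, rfl⟩
      rcases Finset.mem_union.1 hp with hp | hp
      · exact ⟨true, mem_edges_of_mem hp hd⟩
      · exact ⟨false, mem_edges_of_mem hp hd⟩
    · rintro ⟨b, p, hp, d, hd, rfl⟩
      exact mem_edges_of_mem (hBF b hp) hd
  have hnb : ∀ d, E.edge d ∈ E.edges S → E.edge d ∉ E.border := by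
    rintro d ⟨p, hp, x, hx, hxd⟩
    rw [← hxd]
    exact (hS.1 p hp).2.1 x hx
  have hedgeBS : ∀ b, E.edges (B b) ⊆ E.edges S := by
    rintro b _ ⟨p, hp, d, hd, rfl⟩
    exact mem_edges_of_mem (hBS b hp) hd
  have hcolB : ∀ b d, E.edge d ∈ E.edges (B b) → c (E.str d) = b := by
    rintro b d ⟨p, hp, x, hx, hxd⟩
    have := (Finset.mem_filter.1 hp).2.2 x hx
    rcases (E.edge_eq_iff _ _).1 hxd with rfl | rfl
    · exact this
    · rwa [str_rev]
  have hlocal : ∀ v : E.Cell, E.relExp (E.edges (B true)) v + E.relExp (E.edges (B false)) v +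
      ((E.holeDarts (E.edges F)).filter fun d => E.cell d = v).card ≤
        2 * ((E.holeDarts (E.edges S)).filter fun d => E.cell d = v).card := by
    intro v
    by_cases hv : E.Regular v
    · rw [((hBcut true).saturates_of_regular hv).relExp_eq_zero,
        ((hBcut false).saturates_of_regular hv).relExp_eq_zero, Finset.card_eq_zero.2]
      · omega
      · refine Finset.filter_eq_empty_iff.2 ?_
        rintro d hd rfl
        exact (mem_holeDarts.1 hd).2 hv
    · have h1 := (hsat v).relExp_add_relExp_le hc hv (fun b => E.edges (B b)) hedgeBS hcolB
      have h2 : ∀ X : Set E.Edge, X ⊆ E.edges S →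
          ((E.innerDarts v).filter fun d => E.edge d ∈ X) =
            (E.holeDarts X).filter fun d => E.cell d = v := by
        intro X hX
        ext d
        simp only [Finset.mem_filter, mem_innerDarts, mem_holeDarts]
        constructor
        · rintro ⟨⟨rfl, -⟩, h4⟩
          exact ⟨⟨h4, hv⟩, rfl⟩
        · rintro ⟨⟨h4, -⟩, rfl⟩
          exact ⟨⟨rfl, hnb d (hX h4)⟩, h4⟩
      have h3 : E.edges F ⊆ E.edges S := by
        intro e he
        obtain ⟨b, hb⟩ := (hedgesF e).1 he
        exact hedgeBS b hb
      rw [← h2 _ h3, ← h2 _ subset_rfl]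
      simpa only [← hedgesF] using h1
  have hfib : ∀ X : Set E.Edge,
      ∑ v : E.Cell, ((E.holeDarts X).filter fun d => E.cell d = v).card =
        (E.holeDarts X).card := fun X =>
    (Finset.card_eq_sum_card_fiberwise (fun d _ => Finset.mem_coe.2 (Finset.mem_univ _))).symm
  have hsum := Finset.sum_le_sum fun v (_ : v ∈ (Finset.univ : Finset E.Cell)) => hlocal v
  rw [Finset.sum_add_distrib, Finset.sum_add_distrib, hfib, ← Finset.mul_sum, hfib] at hsum
  -- With h counting hole darts: |F| + 2h(S) − h(F) ≤ 2|S| − |F| + h(F) ≤ 2|S| + |F| ≤ 3|S|.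
  have h1 := card_holeDarts_le (E := E) (S := F) fun p hp => hS.1 p (hFS hp)
  have h2 := card_holeDarts_le_of_subset hFS hS.1 hnotF
  have h3 := Finset.card_le_card hFS
  omega

end Count

/-! ### Marginal gain as a constant minus the potential -/

section Gain
variable {D : Type*} [Fintype D] {E : StringSystem D}

theorem gain_eq (S : Finset (List D)) :
    E.gain S = ((∑ v : E.Cell, E.exponent v : ℕ) : ℤ) -
      ((S.card + ∑ v : E.Cell, E.relExp (E.edges S) v : ℕ) : ℤ) := by
  rw [gain, Finset.sum_sub_distrib]
  push_cast
  ring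

/-- The gain is an integer bounded above by the sum of all exponents, and the empty set is a
monochromatic cut-set. -/
theorem exists_isMaxGain (c : E.Str → Bool) : ∃ A, E.IsMaxGain c A := by
  obtain ⟨m, ⟨A, hA1, hA2, hA3⟩, hmax⟩ := Int.exists_greatest_of_bdd
    (P := fun z => ∃ A, E.IsCutSet A ∧ E.IsMonochromatic c A ∧ E.gain A = z)
    ⟨((∑ v : E.Cell, E.exponent v : ℕ) : ℤ), by
      rintro z ⟨A, -, -, rfl⟩
      rw [gain_eq]
      omega⟩
    ⟨_, ∅, ⟨by simp, by simp, by simp⟩, ⟨true, by simp⟩, rfl⟩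
  exact ⟨A, hA1, hA2, fun A' h1 h2 => hA3 ▸ hmax _ ⟨A', h1, h2, rfl⟩⟩

theorem IsMaxGain.two_mul_le {c : E.Str → Bool} (hc : E.IsBipartition c) {A S : Finset (List D)}
    (hA : E.IsMaxGain c A) (hS : E.IsCutSet S) (hsat : ∀ v, E.Saturates (E.edges S) v) :
    2 * (A.card + ∑ v : E.Cell, E.relExp (E.edges A) v) ≤ 3 * S.card := by
  obtain ⟨B, hB, hle⟩ := exists_monochromatic hc hS hsat
  have h1 := hA.2.2 _ (hB true).1 (hB true).2
  have h2 := hA.2.2 _ (hB false).1 (hB false).2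
  rw [gain_eq, gain_eq] at h1 h2
  omega

end Gain

/-! ### Delimiting cut-sets are saturating; the partition into single squares -/

section Rectangle
variable {D : Type*} {E : StringSystem D}

/-- A cell whose boundary walk consists of four darts between four different crossings is
regular. -/
theorem regular_of_face_cycle {a b c d : D} (hab : E.face a = b) (hbc : E.face b = c)
    (hcd : E.face c = d) (hda : E.face d = a) (ha : ¬ E.IsEnd a) (hb : ¬ E.IsEnd b)
    (hc : ¬ E.IsEnd c) (hd : ¬ E.IsEnd d) (hne : [a, b, c, d].Nodup) :
    E.Regular (E.cell a) ∧ ∀ x, E.cell x = E.cell a → x = a ∨ x = b ∨ x = c ∨ x = d := by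
  have ha' : ¬ E.IsEnd (E.rev a) := by rwa [← isEnd_face, hab]
  have hb' : ¬ E.IsEnd (E.rev b) := by rwa [← isEnd_face, hbc]
  have hc' : ¬ E.IsEnd (E.rev c) := by rwa [← isEnd_face, hcd]
  have hd' : ¬ E.IsEnd (E.rev d) := by rwa [← isEnd_face, hda]
  have hmem : ∀ x, E.cell x = E.cell a → x = a ∨ x = b ∨ x = c ∨ x = d := by
    intro x hx
    refine (iff_of_cell_eq (E := E) (P := fun x => x = a ∨ x = b ∨ x = c ∨ x = d) ?_ hx).2
      (Or.inl rfl)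
    intro y _
    rw [← hab, ← E.face.injective.eq_iff (a := y), ← E.face.injective.eq_iff (a := y),
      ← E.face.injective.eq_iff (a := y) (b := c), ← E.face.injective.eq_iff (a := y) (b := d),
      hab, hbc, hcd, hda]
    tauto
  refine ⟨⟨?_, ?_⟩, hmem⟩
  · rintro e ⟨x, rfl, hx⟩
    rw [edge_mem_border_iff]
    rcases hmem x hx with rfl | rfl | rfl | rfl <;> tauto
  · have hset : {x | E.cell x = E.cell a} = {a, b, c, d} := by
      ext x
      refine ⟨fun hx => by simpa using hmem x hx, ?_⟩
      have h1 : E.cell b = E.cell a := hab ▸ E.cell_face ha'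
      have h2 : E.cell c = E.cell a := hbc ▸ (E.cell_face hb').trans h1
      have h3 : E.cell d = E.cell a := hcd ▸ (E.cell_face hc').trans h2
      rintro (rfl | rfl | rfl | rfl)
      exacts [rfl, h1, h2, h3]
    classical
    rw [degree, hset]
    have : ({a, b, c, d} : Set D) = (([a, b, c, d].toFinset : Finset D) : Set D) := by
      ext x
      simp
    rw [this, Set.ncard_coe_finset, List.toFinset_card_of_nodup hne]
    rfl

theorem exists_rot_pow_of_tail_eq {d e : D} (h : E.tail d = E.tail e) :
    e = d ∨ e = E.rot d ∨ e = E.rot (E.rot d) ∨ e = E.rot (E.rot (E.rot d)) := by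
  have h4 : Function.IsPeriodicPt E.rot 4 d := E.rot_four d
  obtain ⟨k, hk⟩ := (E.tail_eq_iff d e).1 h
  have h5 : ∀ k : ℤ, (E.rot ^ k) d = (E.rot ^ (k % 4).toNat) d := by
    intro k
    have h6 : (E.rot ^ (4 : ℤ)) d = d := E.rot_four d
    have h7 : ∀ m : ℤ, (E.rot ^ (4 * m)) d = d := fun m => by
      rw [zpow_mul]
      exact zpow_apply_eq_self_of_apply_eq_self h6 m
    conv_lhs => rw [← Int.emod_add_mul_ediv k 4]
    rw [zpow_add, mul_apply, h7, ← zpow_natCast, Int.toNat_of_nonneg (Int.emod_nonneg _ (by norm_num))]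
  rw [h5] at hk
  have h8 : (k % 4).toNat < 4 := by omega
  generalize (k % 4).toNat = n at hk h8
  subst hk
  interval_cases n
  · exact Or.inl rfl
  · exact Or.inr (Or.inl rfl)
  · exact Or.inr (Or.inr (Or.inl rfl))
  · exact Or.inr (Or.inr (Or.inr rfl))

theorem isEnd_of_tail_eq {d e : D} (h : E.tail d = E.tail e) (hd : E.IsEnd d) : E.IsEnd e := by
  rcases exists_rot_pow_of_tail_eq h with rfl | rfl | rfl | rfl <;> simpa [isEnd_rot] using hd

theorem isCrossing_tail {d : D} : E.IsCrossing (E.tail d) ↔ ¬ E.IsEnd d :=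
  ⟨fun ⟨_, h1, h2⟩ h3 => h2 (isEnd_of_tail_eq h1.symm h3), fun h => ⟨d, rfl, h⟩⟩

theorem rot_ne {d : D} (hd : ¬ E.IsEnd d) :
    E.rot d ≠ d ∧ E.rot (E.rot d) ≠ d ∧ E.rot (E.rot (E.rot d)) ≠ d := by
  refine ⟨hd, E.rot_two d hd, fun h => hd ?_⟩
  have h2 := congrArg E.rot h
  rw [E.rot_four] at h2
  exact h2.symm

/-- A consecutive pair of pieces at a crossing that both stay in the same rectangle bounds a
square of the grid. -/
theorem IsRectangle.face_cycle {Q : Set E.Pt} (hQ : E.IsRectangle Q) {a : D} (ha : E.tail a ∈ Q)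
    (ha1 : E.tail (E.rev a) ∈ Q) (ha2 : E.tail (E.rev (E.rot a)) ∈ Q) :
    E.Regular (E.cell a) ∧
      ∀ x, E.cell x = E.cell a → E.tail x ∈ Q ∧ E.tail (E.rev x) ∈ Q := by
  obtain ⟨n, m, f, -, -, hend, hinj, rfl, hrow, hcol, hind⟩ := hQ
  -- Because the grid is induced, a piece that stays in the rectangle is a grid edge, so its
  -- direction guarantees a grid neighbor on that side.
  have hdir : ∀ i < n, ∀ j < m, ∀ b, E.tail b = E.tail (f i j) →
      E.tail (E.rev b) ∈ {x | ∃ i < n, ∃ j < m, E.tail (f i j) = x} →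
      (b = f i j ∧ j + 1 < m) ∨ (b = E.rot (f i j) ∧ i + 1 < n) ∨
        (b = E.rot (E.rot (f i j)) ∧ 1 ≤ j) ∨ (b = E.rot (E.rot (E.rot (f i j))) ∧ 1 ≤ i) := by
    intro i hi j hj b hb hb2
    rcases hind b ⟨i, hi, j, hj, hb.symm⟩ hb2 with ⟨k, l, hk, hl, he⟩ | ⟨k, l, hk, hl, he⟩
    · rcases (E.edge_eq_iff _ _).1 he with h | h
      · rw [← h] at hb ⊢
        obtain ⟨rfl, rfl⟩ := hinj _ hk _ (by omega) _ hi _ hj hb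
        exact Or.inl ⟨rfl, hl⟩
      · have h2 : b = E.rot (E.rot (f k (l + 1))) := by rw [← hrow k l hk hl, h, E.rev_rev]
        rw [h2, tail_rot, tail_rot] at hb
        obtain ⟨rfl, rfl⟩ := hinj _ hk _ hl _ hi _ hj hb
        exact Or.inr (Or.inr (Or.inl ⟨h2, by omega⟩))
    · rcases (E.edge_eq_iff _ _).1 he with h | h
      · rw [← h, tail_rot] at hb
        obtain ⟨rfl, rfl⟩ := hinj _ (by omega) _ hl _ hi _ hj hb
        exact Or.inr (Or.inl ⟨h.symm, hk⟩)
      · have h2 : b = E.rot (E.rot (E.rot (f (k + 1) l))) := by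
          rw [← hcol k l hk hl, h, E.rev_rev]
        rw [h2, tail_rot, tail_rot, tail_rot] at hb
        obtain ⟨rfl, rfl⟩ := hinj _ hk _ hl _ hi _ hj hb
        exact Or.inr (Or.inr (Or.inr ⟨h2, by omega⟩))
  have hface : ∀ {x y : D}, E.rev x = E.rot y → E.face x = y := fun {x y} h => by
    rw [face_apply, h, Equiv.symm_apply_apply]
  -- The cell inside a 2 × 2 block of the grid is bounded by exactly the four pieces of the block.
  have hblock : ∀ i j, i + 1 < n → j + 1 < m → ∀ a,
      (a = f i j ∨ a = E.rot (f i (j + 1)) ∨ a = E.rot (E.rot (f (i + 1) (j + 1))) ∨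
        a = E.rot (E.rot (E.rot (f (i + 1) j)))) →
      E.Regular (E.cell a) ∧ ∀ x, E.cell x = E.cell a →
        E.tail x ∈ {x | ∃ i < n, ∃ j < m, E.tail (f i j) = x} ∧
          E.tail (E.rev x) ∈ {x | ∃ i < n, ∃ j < m, E.tail (f i j) = x} := by
    intro i j hi hj a hacases
    set p := f i j with hp
    set q := E.rot (f i (j + 1)) with hq
    set r := E.rot (E.rot (f (i + 1) (j + 1))) with hr
    set s := E.rot (E.rot (E.rot (f (i + 1) j))) with hs
    have hpq : E.face p = q := hface (hrow i j (by omega) hj)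
    have hqr : E.face q = r := hface (hcol i (j + 1) hi hj)
    have hrs : E.face r = s := by
      apply hface
      rw [hr, hs, ← hrow (i + 1) j hi hj, E.rev_rev, E.rot_four]
    have hsp : E.face s = p := by
      apply hface
      rw [hs, ← hcol i j hi (by omega), E.rev_rev]
    have tp : E.tail p = E.tail (f i j) := rfl
    have tq : E.tail q = E.tail (f i (j + 1)) := by rw [hq, tail_rot]
    have tr : E.tail r = E.tail (f (i + 1) (j + 1)) := by rw [hr, tail_rot, tail_rot]
    have ts : E.tail s = E.tail (f (i + 1) j) := by rw [hs, tail_rot, tail_rot, tail_rot]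
    have ep : ¬ E.IsEnd p := hend i (by omega) j (by omega)
    have eq' : ¬ E.IsEnd q := by
      rw [hq, isEnd_rot]
      exact hend i (by omega) (j + 1) hj
    have er : ¬ E.IsEnd r := by
      rw [hr, isEnd_rot, isEnd_rot]
      exact hend (i + 1) hi (j + 1) hj
    have es : ¬ E.IsEnd s := by
      rw [hs, isEnd_rot, isEnd_rot, isEnd_rot]
      exact hend (i + 1) hi j (by omega)
    have hnd : [E.tail p, E.tail q, E.tail r, E.tail s].Nodup := by
      have hi' : i < n := by omega
      have hj' : j < m := by omega
      simp only [List.nodup_cons, List.mem_cons, List.not_mem_nil, or_false, not_or,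
        not_false_eq_true, List.nodup_nil, and_true, tp, tq, tr, ts]
      refine ⟨⟨?_, ?_, ?_⟩, ⟨?_, ?_⟩, ?_⟩
      · intro h
        have := hinj _ hi' _ hj' _ hi' _ hj h
        omega
      · intro h
        have := hinj _ hi' _ hj' _ hi _ hj h
        omega
      · intro h
        have := hinj _ hi' _ hj' _ hi _ hj' h
        omega
      · intro h
        have := hinj _ hi' _ hj _ hi _ hj h
        omega
      · intro h
        have := hinj _ hi' _ hj _ hi _ hj' h
        omega
      · intro h
        have := hinj _ hi _ hj _ hi _ hj' h
        omega
    have hnd' : [p, q, r, s].Nodup := List.Nodup.of_map E.tail hnd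
    obtain ⟨hreg, hmem⟩ := regular_of_face_cycle hpq hqr hrs hsp ep eq' er es hnd'
    have hcell : E.cell a = E.cell p := by
      have h1 : E.cell q = E.cell p := hpq ▸ hreg.cell_face
      have h2 : E.cell r = E.cell p := by
        rw [← hqr, Regular.cell_face (by rwa [h1]), h1]
      have h3 : E.cell s = E.cell p := by
        rw [← hrs, Regular.cell_face (by rwa [h2]), h2]
      rcases hacases with rfl | rfl | rfl | rfl
      exacts [rfl, h1, h2, h3]
    rw [hcell]
    refine ⟨hreg, fun x hx => ?_⟩
    have htr : ∀ x, E.tail (E.rev x) = E.tail (E.face x) := fun x => by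
      rw [← E.rot_face, tail_rot]
    rw [htr]
    rcases hmem x hx with rfl | rfl | rfl | rfl
    · rw [hpq, tq]
      exact ⟨⟨i, by omega, j, by omega, rfl⟩, ⟨i, by omega, _, hj, rfl⟩⟩
    · rw [hqr, tr, tq]
      exact ⟨⟨i, by omega, _, hj, rfl⟩, ⟨_, hi, _, hj, rfl⟩⟩
    · rw [hrs, tr, ts]
      exact ⟨⟨_, hi, _, hj, rfl⟩, ⟨_, hi, j, by omega, rfl⟩⟩
    · rw [hsp, ts]
      exact ⟨⟨_, hi, j, by omega, rfl⟩, ⟨i, by omega, j, by omega, rfl⟩⟩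
  obtain ⟨i, hi, j, hj, hij⟩ := ha
  obtain ⟨h0, h00, h000⟩ := rot_ne (hend i hi j hj)
  have ninj : ∀ {x y : D}, E.rot x = E.rot y → x = y := fun h => E.rot.injective h
  -- Of the sixteen pairs of directions, only the four with the second a quarter turn after the
  -- first survive; each places the cell in one block.
  rcases hdir i hi j hj a hij.symm ha1 with ⟨h1, h2⟩ | ⟨h1, h2⟩ | ⟨h1, h2⟩ | ⟨h1, h2⟩ <;>
    rcases hdir i hi j hj (E.rot a) (by rw [tail_rot, hij]) ha2 with
      ⟨h3, h4⟩ | ⟨h3, h4⟩ | ⟨h3, h4⟩ | ⟨h3, h4⟩ <;> rw [h1] at h3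
  · exact absurd h3 h0
  · exact hblock i j h4 h2 a (Or.inl h1)
  · exact absurd (ninj h3).symm h0
  · exact absurd (ninj h3).symm h00
  · exact absurd h3 h00
  · exact absurd (ninj h3) h0
  · obtain ⟨j, rfl⟩ := Nat.exists_eq_add_of_le' h4
    exact hblock i j h2 hj a (Or.inr (Or.inl h1))
  · exact absurd (ninj (ninj h3)).symm h0
  · exact absurd h3 h000
  · exact absurd (ninj h3) h00
  · exact absurd (ninj (ninj h3)) h0
  · obtain ⟨i, rfl⟩ := Nat.exists_eq_add_of_le' h4
    obtain ⟨j, rfl⟩ := Nat.exists_eq_add_of_le' h2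
    exact hblock i j hi hj a (Or.inr (Or.inr (Or.inl h1)))
  · obtain ⟨i, rfl⟩ := Nat.exists_eq_add_of_le' h2
    exact hblock i j hi h4 a (Or.inr (Or.inr (Or.inr h1)))
  · exact absurd (ninj h3) h000
  · exact absurd (ninj (ninj h3)) h00
  · exact absurd (ninj (ninj (ninj h3))) h0

/-- A cut-set that delimits a rectangulation is saturating. -/
theorem Delimits.saturates {S : Finset (List D)} {R : Set (Set E.Pt)} (hR : E.IsRectangulation R)
    (hS : E.Delimits S R) (v : E.Cell) : E.Saturates (E.edges S) v := by
  by_contra hcon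
  have hcon2 : ¬ ∀ d, E.cell d = v → ¬ E.IsEnd (E.rev d) →
      E.edge d ∈ E.edges S ∪ E.border ∨ E.edge (E.face d) ∈ E.edges S ∪ E.border :=
    fun h => hcon (Or.inr h)
  push Not at hcon2
  obtain ⟨d, rfl, hd, h1, h2⟩ := hcon2
  -- Two consecutive uncovered edges are not separating, so the three squares along them lie in one
  -- rectangle. The cell is then inside a grid block, hence regular and free of separating edges.
  have hsame : ∀ x, E.edge x ∉ E.edges S ∪ E.border →
      ∃ Q ∈ R, E.tail x ∈ Q ∧ E.tail (E.rev x) ∈ Q := by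
    intro x hx
    have hb : E.edge x ∉ E.border := fun h => hx (Or.inr h)
    rw [edge_mem_border_iff, not_or] at hb
    obtain ⟨Q, ⟨hQ1, hQ2⟩, -⟩ := hR.2 _ (isCrossing_tail.2 hb.1)
    obtain ⟨Q', ⟨hQ1', hQ2'⟩, -⟩ := hR.2 _ (isCrossing_tail.2 hb.2)
    by_cases h : Q = Q'
    · subst h
      exact ⟨Q, hQ1, hQ2, hQ2'⟩
    · exact absurd (Or.inl ((hS _).2 ⟨x, rfl, Q, hQ1, Q', hQ1', h, hQ2, hQ2'⟩)) hx
  have huniq : ∀ x : E.Pt, ∀ Q ∈ R, ∀ Q' ∈ R, x ∈ Q → x ∈ Q' → Q = Q' := by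
    intro x Q hQ Q' hQ' hx hx'
    have hcr : E.IsCrossing x := by
      obtain ⟨n, m, f, -, -, hend, -, rfl, -⟩ := hR.1 Q hQ
      obtain ⟨i, hi, j, hj, rfl⟩ := hx
      exact ⟨_, rfl, hend i hi j hj⟩
    exact (hR.2 x hcr).unique ⟨hQ, hx⟩ ⟨hQ', hx'⟩
  obtain ⟨Q, hQ, q1, q2⟩ := hsame d h1
  obtain ⟨Q', hQ', q1', q2'⟩ := hsame _ h2
  have hQQ : Q' = Q := by
    refine huniq _ _ hQ' _ hQ q1' ?_
    rw [← tail_rot, rot_face]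
    exact q2
  subst hQQ
  obtain ⟨hreg, hin⟩ := (hR.1 _ hQ).face_cycle q1' q2' (by rwa [rot_face, E.rev_rev])
  rw [E.cell_face hd] at hreg hin
  refine hcon (Or.inl ⟨hreg, ?_⟩)
  rintro e ⟨x, rfl, hx⟩ he
  obtain ⟨y, hy, Q1, hQ1, Q2, hQ2, hne, t1, t2⟩ := (hS _).1 he
  obtain ⟨u1, u2⟩ := hin x hx
  rcases (E.edge_eq_iff _ _).1 hy with rfl | rfl
  · exact hne ((huniq _ _ hQ1 _ hQ t1 u1).trans (huniq _ _ hQ _ hQ2 u2 t2))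
  · rw [E.rev_rev] at u2
    exact hne ((huniq _ _ hQ1 _ hQ t1 u2).trans (huniq _ _ hQ _ hQ2 u1 t2))

/-- No piece joins a crossing to itself. -/
theorem tail_rev_ne {d : D} (hd : ¬ E.IsEnd d) : E.tail (E.rev d) ≠ E.tail d := by
  intro h
  have key : ∀ e, ¬ E.IsEnd e → E.str (E.rot e) ≠ E.str e := fun e he h2 =>
    E.simple e he ((E.str_eq_iff _ _).1 h2.symm)
  rcases exists_rot_pow_of_tail_eq h.symm with h1 | h1 | h1 | h1
  · exact E.rev_ne d h1
  · exact key d hd (by rw [← h1, str_rev])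
  · have h3 : E.fwd d = d := by rw [fwd_apply, h1, E.rot_four]
    obtain ⟨x, hx, hcyc⟩ := E.arc d
    have : d = x := (show SameCycle E.fwd d x from hcyc).eq_of_left h3
    exact hd (this ▸ hx)
  · refine key _ ?_ (show E.str (E.rot (E.rot (E.rot d))) = E.str (E.rot (E.rot d)) from ?_)
    · rwa [isEnd_rot, isEnd_rot]
    · rw [← h1, str_rev, str_rot_rot]

theorem isRectangle_singleton {x : E.Pt} (hx : E.IsCrossing x) : E.IsRectangle {x} := by
  obtain ⟨d, rfl, hd⟩ := hx
  refine ⟨1, 1, fun _ _ => d, le_rfl, le_rfl, fun _ _ _ _ => hd, ?_, ?_, ?_, ?_, ?_⟩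
  · intro i hi j hj k hk l hl _
    omega
  · ext x
    constructor
    · rintro rfl
      exact ⟨0, by omega, 0, by omega, rfl⟩
    · rintro ⟨_, _, _, _, rfl⟩
      rfl
  · intro i j hi hj
    omega
  · intro i j hi hj
    omega
  · intro e h1 h2
    rw [Set.mem_singleton_iff] at h1 h2
    exact absurd (h2.trans h1.symm) (tail_rev_ne fun h => hd (isEnd_of_tail_eq h1 h))

theorem isRectangulation_singletons :
    E.IsRectangulation {Q | ∃ x, E.IsCrossing x ∧ Q = {x}} := by
  refine ⟨?_, fun x hx => ⟨{x}, ⟨⟨x, hx, rfl⟩, rfl⟩, ?_⟩⟩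
  · rintro _ ⟨x, hx, rfl⟩
    exact isRectangle_singleton hx
  · rintro _ ⟨⟨y, -, rfl⟩, h⟩
    rw [Set.mem_singleton_iff] at h
    rw [h]

theorem isSeparating_singletons_iff (d : D) :
    E.IsSeparating {Q | ∃ x, E.IsCrossing x ∧ Q = {x}} (E.edge d) ↔ E.edge d ∉ E.border := by
  constructor
  · rintro ⟨x, hx, _, ⟨y, hy, rfl⟩, _, ⟨z, hz, rfl⟩, -, h1, h2⟩
    rw [Set.mem_singleton_iff] at h1 h2
    rw [← h1, isCrossing_tail] at hy
    rw [← h2, isCrossing_tail] at hz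
    rw [← hx, edge_mem_border_iff]
    tauto
  · intro h
    rw [edge_mem_border_iff, not_or] at h
    refine ⟨d, rfl, _, ⟨_, isCrossing_tail.2 h.1, rfl⟩, _, ⟨_, isCrossing_tail.2 h.2, rfl⟩,
      ?_, rfl, rfl⟩
    rw [Ne, Set.singleton_eq_singleton_iff]
    exact (tail_rev_ne h.1).symm

end Rectangle

/-! ### A cut-set of all non-border edges, and attainment of the minimum -/

section Lines
variable {D : Type*} (E : StringSystem D)

/-- Lines of the net: classes of net-darts under reversing and going straight on at regular
cells. -/
abbrev Line : Type _ :=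
  Quot (fun x y : D => y = E.rev x ∨ (E.Regular (E.cell (E.rev x)) ∧ y = E.step x))

/-- The line of a net-dart. -/
def line (d : D) : E.Line := Quot.mk _ d

/-- A line that meets no hole. -/
def IsClosedLine (l : E.Line) : Prop := ∀ d, E.line d = l → E.Regular (E.cell d)

theorem line_rev (d : D) : E.line (E.rev d) = E.line d :=
  Eq.symm <| by
    apply Quot.sound
    exact Or.inl rfl

variable {E}

theorem line_step {d : D} (h : E.Regular (E.cell (E.rev d))) : E.line (E.step d) = E.line d :=
  Eq.symm <| by
    apply Quot.sound
    exact Or.inr ⟨h, rfl⟩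

theorem line_face_face {d : D} (h : E.Regular (E.cell d)) :
    E.line (E.face (E.face d)) = E.line d := by
  have h1 := line_step (E := E) (d := E.rev d) (by rwa [E.rev_rev])
  rwa [step_apply, E.rev_rev, line_rev] at h1

theorem iff_of_line_eq {P : D → Prop} (h1 : ∀ d, P d ↔ P (E.rev d))
    (h2 : ∀ d, E.Regular (E.cell (E.rev d)) → (P d ↔ P (E.step d))) {d e : D}
    (h : E.line d = E.line e) : P d ↔ P e := by
  let Q : E.Line → Prop := Quot.lift P (by
    rintro x y (rfl | ⟨h3, rfl⟩)
    · exact propext (h1 x)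
    · exact propext (h2 x h3))
  change Q (E.line d) ↔ Q (E.line e)
  rw [h]

theorem color_eq_of_line_eq [Finite D] {c : E.Str → Bool} (hc : E.IsBipartition c) {d e : D}
    (h : E.line d = E.line e) : c (E.str d) = c (E.str e) :=
  ((iff_of_line_eq (P := fun x => c (E.str d) = c (E.str x)) (fun x => by rw [str_rev])
    (fun x hx => by rw [color_step hc hx]) h).1 rfl)

theorem border_iff_of_line_eq {d e : D} (h : E.line d = E.line e) :
    E.edge d ∈ E.border ↔ E.edge e ∈ E.border := by
  refine iff_of_line_eq (P := fun x => E.edge x ∈ E.border) (fun x => by rw [edge_rev])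
    (fun x hx => ?_) h
  have h1 := hx.edge_notMem_border
  rw [edge_rev] at h1
  have h2 : E.Regular (E.cell (E.step x)) := by rwa [cell_step hx]
  exact iff_of_false h1 h2.edge_notMem_border

theorem IsStraight.line_eq {p : List D} (hp : E.IsStraight p) {d e : D} (hd : d ∈ p) (he : e ∈ p) :
    E.line d = E.line e := by
  have key : ∀ (i : ℕ) (hi : i < p.length),
      E.line p[i] = E.line (p[0]'(Nat.zero_lt_of_lt hi)) := by
    intro i
    induction i with
    | zero => intro _; rfl
    | succ i ih =>
      intro hi
      obtain ⟨h1, h2⟩ := hp.getElem_succ hi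
      rw [h2, line_step h1, ih]
  obtain ⟨i, hi, rfl⟩ := List.getElem_of_mem hd
  obtain ⟨j, hj, rfl⟩ := List.getElem_of_mem he
  rw [key i hi, key j hj]

/-- Different cells, one on each closed line, at which the closed lines can be cut. -/
theorem exists_injective_cut [Finite D] {c : E.Str → Bool} (hc : E.IsBipartition c) :
    ∃ w : {l : E.Line // E.IsClosedLine l} → E.Cell, Function.Injective w ∧
      ∀ l, ∃ d, E.line d = l.1 ∧ E.cell d = w l := by
  classical
  let t : {l : E.Line // E.IsClosedLine l} → Finset E.Cell := fun l =>
    Finset.univ.filter fun v => ∃ d, E.line d = l.1 ∧ E.cell d = v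
  have ht : ∀ l v, v ∈ t l ↔ ∃ d, E.line d = l.1 ∧ E.cell d = v := fun l v => by simp [t]
  -- Hall's condition is checked by double counting: a closed line visits at least two cells, as
  -- regular cells carry no loops, and a regular cell lies on at most two lines, one per opposite
  -- pair.
  suffices h : ∀ s : Finset {l : E.Line // E.IsClosedLine l}, s.card ≤ (s.biUnion t).card by
    obtain ⟨w, hw1, hw2⟩ := (Finset.all_card_le_biUnion_card_iff_exists_injective t).1 h
    exact ⟨w, hw1, fun l => (ht _ _).1 (hw2 l)⟩
  intro s
  refine Nat.le_of_mul_le_mul_right (Finset.card_mul_le_card_mul (m := 2) (n := 2)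
    (fun l v => v ∈ t l) ?_ ?_) (by norm_num)
  · intro l hl
    obtain ⟨⟨d⟩, hd⟩ := l
    have hreg : E.Regular (E.cell d) := hd d rfl
    have hsub : ({E.cell d, E.cell (E.rev d)} : Finset E.Cell) ⊆
        (s.biUnion t).bipartiteAbove (fun l v => v ∈ t l) ⟨Quot.mk _ d, hd⟩ := by
      have h1 : E.cell d ∈ t ⟨Quot.mk _ d, hd⟩ := (ht _ _).2 ⟨d, rfl, rfl⟩
      have h2 : E.cell (E.rev d) ∈ t ⟨Quot.mk _ d, hd⟩ :=
        (ht _ _).2 ⟨E.rev d, E.line_rev d, rfl⟩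
      intro v hv
      rw [Finset.mem_insert, Finset.mem_singleton] at hv
      rw [Finset.mem_bipartiteAbove, Finset.mem_biUnion]
      rcases hv with rfl | rfl
      · exact ⟨⟨_, hl, h1⟩, h1⟩
      · exact ⟨⟨_, hl, h2⟩, h2⟩
    refine le_trans ?_ (Finset.card_le_card hsub)
    rw [Finset.card_pair (hreg.cell_rev_ne hc).symm]
  · intro v hv
    obtain ⟨l, hl, hlv⟩ := Finset.mem_biUnion.1 hv
    obtain ⟨e, hel, rfl⟩ := (ht _ _).1 hlv
    have hreg : E.Regular (E.cell e) := l.2 e hel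
    have hreg' : E.Regular (E.cell (E.face e)) := by rwa [hreg.cell_face]
    refine (Finset.card_le_card_of_injOn (t := {E.line e, E.line (E.face e)}) Subtype.val ?_
      Subtype.val_injective.injOn).trans Finset.card_le_two
    intro k hk
    rw [Finset.mem_coe, Finset.mem_bipartiteBelow] at hk
    obtain ⟨x, hx, hxe⟩ := (ht _ _).1 hk.2
    rw [← hx, Finset.mem_coe, Finset.mem_insert, Finset.mem_singleton]
    rcases hreg.eq_or_of_cell_eq hxe with rfl | rfl | rfl | rfl
    · exact Or.inl rfl
    · exact Or.inr rfl
    · exact Or.inl (line_face_face hreg)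
    · exact Or.inr (line_face_face hreg')

/-- A line is covered by one straight path, whose ends are on holes, or at a prescribed cell if
the line is closed. -/
theorem exists_isStraight_line [Finite D] {c : E.Str → Bool} (hc : E.IsBipartition c)
    (w : {l : E.Line // E.IsClosedLine l} → E.Cell)
    (hw : ∀ l, ∃ d, E.line d = l.1 ∧ E.cell d = w l) {l : E.Line}
    (hl : ∃ d, E.line d = l ∧ E.edge d ∉ E.border) :
    ∃ p, E.IsStraight p ∧ (∀ x ∈ p, E.line x = l) ∧ (∀ x, E.line x = l → x ∈ p ∨ E.rev x ∈ p) ∧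
      ∀ v, E.IsEndOf p v → ¬ E.Regular v ∨ ∃ h, w ⟨l, h⟩ = v := by
  -- The walk stops at holes and, on a closed line, at the cut chosen for that line; cuts of other
  -- lines are passed through.
  set St : D → Prop := fun x => ¬ E.Regular (E.cell x) ∨ ∃ h, w ⟨E.line x, h⟩ = E.cell x with hSt
  have hstart : ∃ s, E.line s = l ∧ E.edge s ∉ E.border ∧ St s := by
    obtain ⟨d, rfl, hd⟩ := hl
    by_cases hcl : E.IsClosedLine (E.line d)
    · obtain ⟨s, hs1, hs2⟩ := hw ⟨_, hcl⟩
      refine ⟨s, hs1, fun h => hd ((border_iff_of_line_eq hs1).1 h), Or.inr ?_⟩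
      simp only [hs1]
      exact ⟨hcl, hs2.symm⟩
    · unfold IsClosedLine at hcl
      push Not at hcl
      obtain ⟨s, hs1, hs2⟩ := hcl
      exact ⟨s, hs1, fun h => hd ((border_iff_of_line_eq hs1).1 h), Or.inl hs2⟩
  obtain ⟨s, rfl, hsb, hss⟩ := hstart
  obtain ⟨p, hp, hhead, -, hlast⟩ := exists_isStraight St
    (fun x hx => by by_contra h; exact hx (Or.inl h))
    (fun x hx h => by
      have hx' : E.Regular (E.cell (E.face x)) := by rwa [hx.cell_face]
      simp only [hSt, line_face_face hx, hx'.cell_face, hx.cell_face] at h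
      exact h) hsb hss
  have hsp : s ∈ p := List.mem_of_mem_head? hhead
  obtain ⟨z, hz⟩ : ∃ z, p.getLast? = some z :=
    ⟨_, List.getLast?_eq_some_getLast hp.1⟩
  have hzp : z ∈ p := List.mem_of_mem_getLast? hz
  have hzl : E.line (E.rev z) = E.line s := (E.line_rev z).trans (hp.line_eq hzp hsp)
  have hzs : St (E.rev z) := hlast z hz
  have hSt' : ∀ x, E.line x = E.line s → St x →
      ¬ E.Regular (E.cell x) ∨ ∃ h, w ⟨E.line s, h⟩ = E.cell x := by
    intro x hx h
    simpa only [hSt, hx] using h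
  refine ⟨p, hp, fun x hx => hp.line_eq hx hsp, ?_, ?_⟩
  swap
  · rintro v (⟨x, hx, rfl⟩ | ⟨x, hx, rfl⟩)
    · rw [hhead] at hx
      cases hx
      exact hSt' _ rfl hss
    · rw [hz] at hx
      cases hx
      exact hSt' _ hzl hzs
  have hne : E.rev z ≠ s := by
    intro h
    have h1 := List.inj_on_of_nodup_map hp.2.2.1 hzp hsp (by rw [← h, edge_rev])
    exact E.rev_ne z (h.trans h1.symm)
  -- On a closed line both ends of the path are at the cut. They have the same color and are
  -- distinct darts, so they are opposite and the path closes up.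
  have hclosed : E.IsClosedLine (E.line s) → E.Regular (E.cell s) ∧
      E.face (E.face s) = E.rev z ∧ E.face (E.face (E.rev z)) = s := by
    intro hcl
    have r1 : E.Regular (E.cell s) := hcl s rfl
    have r2 : E.Regular (E.cell (E.rev z)) := hcl _ hzl
    obtain ⟨_, h1⟩ := (hSt' _ rfl hss).resolve_left (not_not_intro r1)
    obtain ⟨_, h2⟩ := (hSt' _ hzl hzs).resolve_left (not_not_intro r2)
    have h3 : E.rev z = E.face (E.face s) :=
      (r1.eq_or_eq_of_color hc (h2.symm.trans h1) (color_eq_of_line_eq hc hzl)).resolve_left hne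
    exact ⟨r1, h3.symm, by rw [h3, r1.face_four]⟩
  -- The edges of `p` are closed under going straight on, so they exhaust the line; at the ends of
  -- `p` this uses `hclosed`.
  have hfwd : ∀ x, E.Regular (E.cell (E.rev x)) → (x ∈ p ∨ E.rev x ∈ p) →
      (E.step x ∈ p ∨ E.rev (E.step x) ∈ p) := by
    rintro x hx (h | h)
    · obtain ⟨i, hi, rfl⟩ := List.getElem_of_mem h
      by_cases hi2 : i + 1 < p.length
      · left
        rw [← (hp.getElem_succ hi2).2]
        exact List.getElem_mem _
      · have hiz : p[i] = z := by
          have : i = p.length - 1 := by omega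
          subst this
          rw [List.getLast?_eq_getElem?, List.getElem?_eq_getElem hi] at hz
          exact Option.some_injective _ hz
        rw [hiz] at hx ⊢
        obtain ⟨hcl, -⟩ := (hSt' _ hzl hzs).resolve_left (not_not_intro hx)
        left
        rw [step_apply, (hclosed hcl).2.2]
        exact hsp
    · obtain ⟨i, hi, hix⟩ := List.getElem_of_mem h
      rcases i with _ | i
      · have his : E.rev x = s := by
          rw [List.head?_eq_getElem?, List.getElem?_eq_getElem hi] at hhead
          exact hix.symm.trans (Option.some_injective _ hhead)
        rw [his] at hx
        obtain ⟨hcl, -⟩ := (hSt' _ rfl hss).resolve_left (not_not_intro hx)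
        right
        rw [step_apply, his, (hclosed hcl).2.1, E.rev_rev]
        exact hzp
      · obtain ⟨h1, h2⟩ := hp.getElem_succ hi
        right
        have h3 := step_rev_step h1
        rw [← h2, hix, E.rev_rev] at h3
        rw [h3, E.rev_rev]
        exact List.getElem_mem _
  intro x hx
  refine (iff_of_line_eq (P := fun x => x ∈ p ∨ E.rev x ∈ p) ?_ ?_ hx).2 (Or.inl hsp)
  · intro y
    rw [E.rev_rev]
    exact or_comm
  · intro y hy
    refine ⟨hfwd y hy, fun h => ?_⟩
    have h1 := hfwd (E.rev (E.step y)) (by rwa [E.rev_rev, cell_step hy])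
      (by rw [E.rev_rev]; exact h.symm)
    rw [step_rev_step hy, E.rev_rev] at h1
    exact h1.symm

/-- There is a cut-set that consists of all non-border edges. -/
theorem exists_isCutSet_all [Finite D] {c : E.Str → Bool} (hc : E.IsBipartition c) :
    ∃ S, E.IsCutSet S ∧ ∀ d, E.edge d ∈ E.edges S ↔ E.edge d ∉ E.border := by
  classical
  have := Fintype.ofFinite E.Line
  obtain ⟨w, hinj, hw⟩ := exists_injective_cut hc
  choose! P hP using fun (l : E.Line) (hl : ∃ d, E.line d = l ∧ E.edge d ∉ E.border) =>
    exists_isStraight_line hc w hw hl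
  set S := (Finset.univ.filter fun l : E.Line =>
    ∃ d, E.line d = l ∧ E.edge d ∉ E.border).image P with hS
  have hmem : ∀ p, p ∈ S ↔ ∃ l, (∃ d, E.line d = l ∧ E.edge d ∉ E.border) ∧ P l = p := by
    intro p
    simp [hS]
  refine ⟨S, ⟨?_, ?_, ?_⟩, ?_⟩
  · intro p hp
    obtain ⟨l, hl, rfl⟩ := (hmem p).1 hp
    exact (hP l hl).1
  · intro p hp q hq hpq x hx y hy hxy
    obtain ⟨l, hl, rfl⟩ := (hmem p).1 hp
    obtain ⟨k, hk, rfl⟩ := (hmem q).1 hq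
    refine hpq (congrArg P ?_)
    rw [← (hP l hl).2.1 x hx, ← (hP k hk).2.1 y hy]
    rcases (E.edge_eq_iff _ _).1 hxy with rfl | rfl
    · rfl
    · rw [line_rev]
  · intro p hp v hv
    obtain ⟨l, hl, rfl⟩ := (hmem p).1 hp
    by_cases hreg : E.Regular v
    swap
    · exact Or.inl hreg
    right
    obtain ⟨hcl, rfl⟩ := ((hP l hl).2.2.2 v hv).resolve_left (not_not_intro hreg)
    obtain ⟨e, he1, he2⟩ := hw ⟨l, hcl⟩
    rw [← he2] at hreg ⊢
    have hcell : E.cell (E.face e) = E.cell e := hreg.cell_face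
    have hreg' : E.Regular (E.cell (E.face e)) := by rwa [hcell]
    set k := E.line (E.face e) with hk
    have hkl : k ≠ l := by
      intro h
      have h1 := color_eq_of_line_eq hc (h.trans he1.symm)
      rw [hc.face hreg.not_isEnd_rev] at h1
      simp at h1
    have hk2 : ∃ d, E.line d = k ∧ E.edge d ∉ E.border := ⟨_, rfl, hreg'.edge_notMem_border⟩
    obtain ⟨q1, q2, q3, q4⟩ := hP k hk2
    refine ⟨P k, (hmem _).2 ⟨k, hk2, rfl⟩, ?_, ?_⟩
    · intro h
      obtain ⟨x, hx⟩ := List.exists_mem_of_ne_nil _ q1.1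
      refine hkl ((q2 x hx).symm.trans ?_)
      rw [h] at hx
      exact (hP l hl).2.1 x hx
    -- The line `k` of the other color passes through the cut of `l`. Since the cuts are distinct,
    -- `k` is not cut there, so its path has this cell in its interior.
    · have hin : E.IsInnerOf (P k) (E.cell e) ∨ E.IsEndOf (P k) (E.cell e) := by
        rcases q3 _ hk.symm with h | h
        · exact q1.isInnerOf_or_isEndOf h ⟨_, rfl, hcell⟩
        · exact q1.isInnerOf_or_isEndOf h ⟨_, (E.edge_rev _).symm, hcell⟩
      refine hin.resolve_right fun h => ?_
      obtain ⟨hcl', h1⟩ := (q4 _ h).resolve_left (not_not_intro hreg)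
      rw [he2] at h1
      exact hkl (congrArg Subtype.val (hinj h1))
  · intro d
    constructor
    · rintro ⟨p, hp, x, hx, hxd⟩
      obtain ⟨l, hl, rfl⟩ := (hmem p).1 hp
      rw [← hxd]
      exact (hP l hl).1.2.1 x hx
    · intro hd
      have hl : ∃ e, E.line e = E.line d ∧ E.edge e ∉ E.border := ⟨d, rfl, hd⟩
      have hp : P (E.line d) ∈ S := (hmem _).2 ⟨_, hl, rfl⟩
      rcases (hP _ hl).2.2.1 d rfl with h | h
      · exact mem_edges_of_mem hp h
      · rw [← edge_rev]
        exact mem_edges_of_mem hp h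

/-- An infimum over an empty set would be 0, so a delimiting cut-set must be exhibited: all
non-border edges delimit the partition into single squares. -/
theorem sOpt_spec [Finite D] {c : E.Str → Bool} (hc : E.IsBipartition c) :
    ∃ S R, E.IsCutSet S ∧ E.IsRectangulation R ∧ E.Delimits S R ∧ S.card = E.sOpt := by
  refine Nat.sInf_mem (s := {k | ∃ S R, E.IsCutSet S ∧ E.IsRectangulation R ∧ E.Delimits S R ∧
    S.card = k}) ?_
  obtain ⟨S, h1, h2⟩ := exists_isCutSet_all hc
  refine ⟨_, S, _, h1, isRectangulation_singletons, ?_, rfl⟩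
  rintro ⟨d⟩
  exact (h2 d).trans (isSeparating_singletons_iff d).symm

end Lines

end StringSystem

/-! ### The main theorem -/

open StringSystem in
theorem mainTheorem3 {D : Type*} [Fintype D] [DecidableEq D] (E : StringSystem D)
    (c : E.Str → Bool) (hc : E.IsBipartition c) :
    (∃ A, E.IsMaxGain c A) ∧
    ∀ A, E.IsMaxGain c A →
      ∀ vs : List E.Cell, vs.Nodup → (∀ v, v ∈ vs ↔ 0 < E.exponent v) →
        (∃ S, E.Greedy vs A S) ∧
        ∀ S, E.Greedy vs A S →
          E.IsCutSet S ∧ E.IsNoncrossing S ∧ (∀ v, E.Saturates (E.edges S) v) ∧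
          (S.card : ℚ) ≤ 3 / 2 * (E.sOpt : ℚ) := by
  refine ⟨exists_isMaxGain c, fun A hA vs _ hvs => ?_⟩
  have hreg : ∀ v ∈ vs, ¬ E.Regular v := fun v hv h => by
    have h1 := (hvs v).1 hv
    rw [exponent_of_regular h] at h1
    exact lt_irrefl _ h1
  refine ⟨exists_greedy vs hreg A, fun S hS => ?_⟩
  obtain ⟨h1, h2, -, h4, h5⟩ := hS.spec hreg hA.1 (hA.1.isNoncrossing hc hA.2.1)
  refine ⟨h1, h2, fun v => ?_, ?_⟩
  · by_cases hv : E.Regular v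
    · exact h1.saturates_of_regular hv
    · by_cases hmem : v ∈ vs
      · exact h4 v hmem
      -- A hole vertex of exponent zero is saturated by the empty set, hence by every set of edges.
      · rw [hvs, Nat.pos_iff_ne_zero, not_not] at hmem
        exact (saturates_of_relExp_eq_zero hmem).mono hv fun _ _ h => h.elim
  · obtain ⟨T, R, t1, t2, t3, t4⟩ := sOpt_spec hc
    have h6 := hA.two_mul_le hc t1 (t3.saturates t2)
    rw [t4] at h6
    have h7 : 2 * S.card ≤ 3 * E.sOpt := by omega
    have h8 : (2 * S.card : ℚ) ≤ 3 * E.sOpt := by exact_mod_cast h7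
    linarith
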